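/- Let $r\ge 2$ be a fixed integer. For positive integers $k\le n$ let $\Theta_k=\{v\in\{0,1\}^n:\|v\|_0=k\}$, where $\|v\|_0$ is the number of nonzero entries of $v$. Let $\theta\sim\mathrm{Unif}(\Theta_k)$, let $W\in\mathbb{R}^{n^{\otimes r}}$ be independent of $\theta$ with i.i.d. $\mathcal N(0,1)$ entries, and, for $\lambda\in\mathbb{R}$, let $$Y=\frac{\lambda}{k^{r/2}}\,\theta^{\otimes r}+W .$$ Greedy peeling with input $Y$ is the following algorithm. Put $Q=\max\{Y,0\}$ (entrywise) and $P^0=\mathbf 1\in\mathbb{R}^n$. For $t=0,1,\dots,\lceil n-\tfrac32k\rceil-1$, choose $\ell\in\arg\min_{i:\,P^t_i=1}\langle e_i\otimes (P^t)^{\otimes (r-1)},Q\rangle$ (ties being broken arbitrarily), and let $P^{t+1}$ be $P^t$ with its $\ell$-th coordinate set to $0$. Output $P^{\lceil n-\frac32k\rceil}$. Theorem. There is a constant $C_\lambda=C_\lambda(r)>0$ such that the following holds. Let $k=k_n$ and $\lambda=\lambda_n$ be sequences such that $k_n\ge c\sqrt n$ for some constant $c>0$ and all large $n$, and such that, for all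 large $n$, $k_n\le\frac23n$ and $$\lambda_n\ \ge\ C_\lambda\,\frac{n^{\frac{r-1}{2}}}{k_n^{\frac r2-1}}\,\sqrt{\log n}.$$ Then with probability tending to $1$ as $n\to\infty$, whichever way ties are broken, greedy peeling with input $Y$ outputs a vector $\sigma\in\{0,1\}^n$ with $\|\sigma\|_0\le\frac32k_n$ and $\langle\sigma,\theta\rangle\ge\frac18k_n$. -/

import Mathlib

open MeasureTheory ProbabilityTheory Filter Topology

noncomputable section

namespace SparseTensorPCA

/-- Real tensors of order `r` over `[n]`. -/
abbrev Tensor (n r : ℕ) : Type := (Fin r → Fin n) → ℝ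

/-- The rank-one tensor `v 0 ⊗ v 1 ⊗ ⋯ ⊗ v (r - 1)`. -/
def rankOne {n r : ℕ} (v : Fin r → Fin n → ℝ) : Tensor n r :=
  fun j => ∏ m, v m (j m)

/-- The entrywise inner product of two tensors. -/
def tensorInner {n r : ℕ} (A B : Tensor n r) : ℝ := ∑ j, A j * B j

/-- The set of binary `k`-sparse vectors; `hammingNorm v` is the number of nonzero entries of `v`. -/
def sparseBinary (n k : ℕ) : Set (Fin n → ℝ) :=
  {v | (∀ i, v i = 0 ∨ v i = 1) ∧ hammingNorm v = k}

/-- The joint law of the signal and the noise: the signal is uniform on the binary `k`-sparse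
vectors, the noise has i.i.d. standard Gaussian entries, and the two are independent. -/
def jointLaw (n k r : ℕ) : Measure ((Fin n → ℝ) × Tensor n r) :=
  (uniformOn (sparseBinary n k)).prod (Measure.pi fun _ => gaussianReal 0 1)

/-- The observation `Y = (lam / k ^ (r / 2)) • θ ^ ⊗ r + W`. -/
def observation {n r : ℕ} (k : ℕ) (lam : ℝ) (θ : Fin n → ℝ) (W : Tensor n r) : Tensor n r :=
  fun j => lam / (k : ℝ) ^ ((r : ℝ) / 2) * rankOne (fun _ => θ) j + W j

/-- The entrywise truncation `max (Y, 0)`. -/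
def truncate {n r : ℕ} (Y : Tensor n r) : Tensor n r := fun j => max (Y j) 0

/-- The score `⟨e_i ⊗ P ^ ⊗ (r - 1), Q⟩` of the coordinate `i`. -/
def score {n r : ℕ} (Q : Tensor n r) (P : Fin n → ℝ) (i : Fin n) : ℝ :=
  tensorInner (rankOne fun m => if (m : ℕ) = 0 then Pi.single i 1 else P) Q

/-- `ℓ` is a minimizer of the score over the coordinates `i` with `P i = 1`. -/
def IsMinimizer {n r : ℕ} (Q : Tensor n r) (P : Fin n → ℝ) (ℓ : Fin n) : Prop :=
  P ℓ = 1 ∧ ∀ i, P i = 1 → score Q P ℓ ≤ score Q P i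

/-- The possible values of the iterate `P ^ t` of greedy peeling on `Q`, started from the all-ones
vector: every step sets to zero one minimizing coordinate, ties being broken arbitrarily. -/
def iterates {n r : ℕ} (Q : Tensor n r) : ℕ → Set (Fin n → ℝ)
  | 0 => {fun _ => 1}
  | t + 1 => {P' | ∃ P ∈ iterates Q t, ∃ ℓ, IsMinimizer Q P ℓ ∧ P' = Function.update P ℓ 0}

/-- The possible outputs of greedy peeling with input `Y`: the iterates after
`⌈n - 3k/2⌉ = n - ⌊3k/2⌋` steps on `Q = max (Y, 0)`. -/
def outputs {n r : ℕ} (k : ℕ) (Y : Tensor n r) : Set (Fin n → ℝ) :=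
  iterates (truncate Y) (n - 3 * k / 2)

/-- Greedy peeling with input `Y` produces an output, and whichever way ties are broken its output
is a binary vector with at most `3k/2` nonzero entries and overlap at least `k/8` with `θ`. -/
def Succeeds {n r : ℕ} (k : ℕ) (θ : Fin n → ℝ) (Y : Tensor n r) : Prop :=
  (outputs k Y).Nonempty ∧
    ∀ σ ∈ outputs k Y, (∀ i, σ i = 0 ∨ σ i = 1) ∧
      (hammingNorm σ : ℝ) ≤ 3 / 2 * (k : ℝ) ∧ (k : ℝ) / 8 ≤ σ ⬝ᵥ θ

end SparseTensorPCA

end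

/-! If fewer than `k / 8` support vertices survived, consider the first time this happens. Every
support vertex removed earlier had the least score at its removal. While more than about `3k / 2`
vertices remain, a third of them lie outside the support `S`, so unless the mean outside score
exceeds its expectation by `R ≍ √(n ^ (r-1) log n)`, the least score is at most `|P| ^ (r-1) *
meanPosPart + R`. A support vertex that still sees `k / 8` of the support has expected score at
least `R` above this level. So many support vertices have scores well below their means
(`measure_forall_le_le`).

The difficulty is that the sets at which these deviations occur depend on the noise, and a union
bound over whole runs is far too expensive. But the score of `i` reads only the entries with first
index `i`. Given the rows outside `S`, a run is essentially determined by the removal times of the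
`k` support vertices, which have at most `(n+1) ^ k` values. For each choice of times the sets are
fixed, the support rows are still fresh, and the failure probability `n ^ (-8k)` beats the count
(`measure_hasLowRun_le`).

Determination could fail through ties. Positive ties have probability zero (`measure_tie_eq_zero`),
but truncation allows many zero scores. The core of a set ignores the order in which zero-score
vertices go, and it is everything outside `S` when all scores there are positive (`IsPath.core_eq`,
`IsPath.eq_of_pos`). Support vertices removed with score zero are handled separately: by
monotonicity their scores all vanish at one common later set, which is unlikely for a quarter of the
support (`measure_sum_nonpos_le`). -/

namespace GreedyPeeling

/-! ### Comparison of peeling runs through their cores -/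

section Paths

variable {V : Type*} [Fintype V] [DecidableEq V]

/-- `p 0, …, p L` is a run of greedy peeling for the scores `f P i`, started from all of `V`. -/
def IsPath (f : Finset V → V → ℝ) (p : ℕ → Finset V) (L : ℕ) : Prop :=
  p 0 = Finset.univ ∧
    ∀ t < L, ∃ ℓ ∈ p t, (∀ i ∈ p t, f (p t) ℓ ≤ f (p t) i) ∧ p (t + 1) = (p t).erase ℓ

open Classical in
/-- The largest set `N` of vertices of `P` outside `S` whose scores in `P ∩ S ∪ N` are positive. -/
noncomputable def core (f : Finset V → V → ℝ) (S P : Finset V) : Finset V :=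
  (P \ S).filter fun i => ∃ N ⊆ P \ S, i ∈ N ∧ ∀ l ∈ N, 0 < f (P ∩ S ∪ N) l

variable {f g : Finset V → V → ℝ} {S P P' : Finset V}

lemma mem_core {i : V} :
    i ∈ core f S P ↔ i ∈ P \ S ∧ ∃ N ⊆ P \ S, i ∈ N ∧ ∀ l ∈ N, 0 < f (P ∩ S ∪ N) l := by
  classical
  simp [core]

lemma core_subset : core f S P ⊆ P \ S := fun _ hi => (mem_core.1 hi).1

lemma subset_core {N : Finset V} (hN : N ⊆ P \ S) (h : ∀ l ∈ N, 0 < f (P ∩ S ∪ N) l) :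
    N ⊆ core f S P := fun _ hi => mem_core.2 ⟨hN hi, N, hN, hi, h⟩

/-- Scores increase with the vertex set, so enlarging an admissible `N` to the union of all of them
keeps its scores positive. Hence the core is itself admissible. -/
lemma core_pos (hf : ∀ i, Monotone fun P => f P i) {l : V} (hl : l ∈ core f S P) :
    0 < f (P ∩ S ∪ core f S P) l := by
  obtain ⟨-, N, hN, hlN, hpos⟩ := mem_core.1 hl
  exact (hpos l hlN).trans_le
    (hf l (Finset.union_subset_union_right (subset_core hN hpos)))

lemma core_mono (hf : ∀ i, Monotone fun P => f P i) (h : P ⊆ P') :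
    core f S P ⊆ core f S P' := by
  refine subset_core (core_subset.trans (Finset.sdiff_subset_sdiff h subset_rfl)) fun l hl => ?_
  exact (core_pos hf hl).trans_le (hf l (Finset.union_subset_union_left
    (Finset.inter_subset_inter_right h)))

lemma core_congr (hfg : ∀ P, ∀ i ∉ S, f P i = g P i) : core f S P = core g S P := by
  ext i
  simp only [mem_core]
  refine and_congr_right fun _ => exists_congr fun N => and_congr_right fun hN =>
    and_congr_right fun _ => forall₂_congr fun l hl => ?_
  rw [hfg _ l (Finset.mem_sdiff.1 (hN hl)).2]

/-- This recovers the vertex set from its core: nothing is lost when no outside score vanishes. -/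
lemma core_eq_iff (hf : ∀ i, Monotone fun P => f P i) :
    core f S P = P \ S ↔ ∀ i ∈ P \ S, 0 < f P i := by
  have hP : P ∩ S ∪ P \ S = P := by
    rw [Finset.union_comm]; exact Finset.sdiff_union_inter P S
  constructor
  · intro h i hi
    have := core_pos hf (h.symm ▸ hi : i ∈ core f S P)
    rwa [h, hP] at this
  · intro h
    refine core_subset.antisymm (subset_core subset_rfl ?_)
    rwa [hP]

/-- Removing a vertex of score zero changes the core in a way that depends only on the core and on
the part of the vertex set that lies in `S`. -/
lemma core_erase_of_zero (hf : ∀ i, Monotone fun P => f P i) {ℓ : V} (hℓ : f P ℓ ≤ 0) :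
    core f S (P.erase ℓ) = core f S ((P.erase ℓ) ∩ S ∪ core f S P) := by
  -- A core vertex has positive score in a subset of `P`, hence in `P`. So erasing `ℓ` leaves the
  -- old core intact.
  have hnot : ℓ ∉ core f S P := fun h => by
    refine absurd ((core_pos hf h).trans_le (hf ℓ ?_)) (not_lt.2 hℓ)
    exact Finset.union_subset Finset.inter_subset_left (core_subset.trans Finset.sdiff_subset)
  have hS : ((P.erase ℓ) ∩ S ∪ core f S P) ∩ S = (P.erase ℓ) ∩ S := by
    ext i
    have : i ∈ core f S P → i ∉ S := fun h => (Finset.mem_sdiff.1 (core_subset h)).2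
    simp only [Finset.mem_inter, Finset.mem_union]
    tauto
  have hN : ((P.erase ℓ) ∩ S ∪ core f S P) \ S = core f S P := by
    ext i
    have : i ∈ core f S P → i ∉ S := fun h => (Finset.mem_sdiff.1 (core_subset h)).2
    simp only [Finset.mem_inter, Finset.mem_union, Finset.mem_sdiff]
    tauto
  apply Finset.Subset.antisymm
  · refine subset_core (N := core f S (P.erase ℓ)) ?_ fun l hl => ?_
    · rw [hN]; exact core_mono hf (Finset.erase_subset _ _)
    · rw [hS]; exact core_pos hf hl
  · refine core_mono hf (Finset.union_subset Finset.inter_subset_left fun i hi => ?_)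
    refine Finset.mem_erase.2 ⟨fun h => hnot (h ▸ hi), (Finset.mem_sdiff.1 (core_subset hi)).1⟩

lemma IsPath.card {p : ℕ → Finset V} {L : ℕ} (hp : IsPath f p L) :
    ∀ t ≤ L, (p t).card = Fintype.card V - t := by
  intro t
  induction t with
  | zero => intro _; simp [hp.1]
  | succ t ih =>
    intro ht
    obtain ⟨ℓ, hℓ, -, h⟩ := hp.2 t ht
    rw [h, Finset.card_erase_of_mem hℓ, ih (by omega)]
    omega

lemma IsPath.mono {p : ℕ → Finset V} {L L' : ℕ} (hp : IsPath f p L) (h : L' ≤ L) :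
    IsPath f p L' := ⟨hp.1, fun t ht => hp.2 t (ht.trans_le h)⟩

lemma IsPath.subset {p : ℕ → Finset V} {L : ℕ} (hp : IsPath f p L) {s t : ℕ} (hst : s ≤ t)
    (ht : t ≤ L) : p t ⊆ p s := by
  induction t, hst using Nat.le_induction with
  | base => exact subset_rfl
  | succ t hst ih =>
    obtain ⟨ℓ, -, -, h⟩ := hp.2 t ht
    rw [h]
    exact (Finset.erase_subset _ _).trans (ih (by omega))

/-- Two runs whose scores agree outside `S`, without positive ties there, and which visit the same
subsets of `S`, have the same cores. -/
lemma IsPath.core_eq (hf : ∀ i, Monotone fun P => f P i) (hg : ∀ i, Monotone fun P => g P i)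
    (hfg : ∀ P, ∀ i ∉ S, f P i = g P i)
    (htie : ∀ P, ∀ i ∉ S, ∀ l ∉ S, f P i = f P l → 0 < f P i → i = l)
    {p q : ℕ → Finset V} {L : ℕ} (hp : IsPath f p L) (hq : IsPath g q L)
    (hS : ∀ t ≤ L, p t ∩ S = q t ∩ S) :
    ∀ t ≤ L, core f S (p t) = core f S (q t) := by
  intro t
  induction t with
  | zero => intro _; rw [hp.1, hq.1]
  | succ t ih =>
    intro ht
    have hc := ih (by omega)
    obtain ⟨ℓ, hℓ, hmin, h⟩ := hp.2 t ht
    obtain ⟨ℓ', hℓ', hmin', h'⟩ := hq.2 t ht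
    have hSt := hS t (by omega)
    have hSt1 := hS (t + 1) ht
    -- Each run deletes one vertex per step, so equal traces on `S` leave equally many vertices
    -- outside. This carries the case distinction below from one run to the other.
    have hcard : (p t \ S).card = (q t \ S).card := by
      have h1 := Finset.card_inter_add_card_sdiff (p t) S
      have h2 := Finset.card_inter_add_card_sdiff (q t) S
      rw [hp.card t (by omega)] at h1
      rw [hq.card t (by omega)] at h2
      rw [hSt] at h1
      omega
    by_cases hA : core f S (p t) = p t \ S
    · have hA' : core f S (q t) = q t \ S :=
        Finset.eq_of_subset_of_card_le core_subset (by rw [← hc, hA, hcard])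
      have hpq : p t = q t := by
        rw [← Finset.sdiff_union_inter (p t) S, ← Finset.sdiff_union_inter (q t) S, ← hA, ← hA',
          hc, hSt]
      rw [h, h', hpq]
      rw [h, h', hpq] at hSt1
      rw [hpq] at hmin hℓ
      have hpos := (core_eq_iff hf).1 hA'
      congr 2
      -- If one of the deleted vertices is in `S`, the traces on `S` at time `t + 1` identify it
      -- with the other. Otherwise both minimize the same positive scores, and there are no ties.
      by_cases hℓS : ℓ ∈ S
      · by_contra hne
        have : ℓ ∈ (q t).erase ℓ' ∩ S :=
          Finset.mem_inter.2 ⟨Finset.mem_erase.2 ⟨hne, hℓ⟩, hℓS⟩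
        rw [← hSt1] at this
        simp at this
      · by_cases hℓS' : ℓ' ∈ S
        · by_contra hne
          have : ℓ' ∈ (q t).erase ℓ ∩ S :=
            Finset.mem_inter.2 ⟨Finset.mem_erase.2 ⟨Ne.symm hne, hℓ'⟩, hℓS'⟩
          rw [hSt1] at this
          simp at this
        · refine htie (q t) ℓ hℓS ℓ' hℓS' (le_antisymm (hmin _ hℓ') ?_)
            (hpos ℓ (Finset.mem_sdiff.2 ⟨hℓ, hℓS⟩))
          rw [hfg _ _ hℓS, hfg _ _ hℓS']
          exact hmin' _ hℓ
    -- Now both runs have a nonpositive minimum. They may delete different vertices, but the core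
    -- changes in the same way.
    · have hA' : core f S (q t) ≠ q t \ S := fun hA' => hA
        (Finset.eq_of_subset_of_card_le core_subset (by rw [hc, hA', hcard]))
      have hz : f (p t) ℓ ≤ 0 := by
        by_contra hpos
        exact hA ((core_eq_iff hf).2 fun i hi =>
          (not_le.1 hpos).trans_le (hmin i (Finset.mem_sdiff.1 hi).1))
      have hz' : g (q t) ℓ' ≤ 0 := by
        by_contra hpos
        refine hA' ((core_eq_iff hf).2 fun i hi => ?_)
        rw [hfg _ _ (Finset.mem_sdiff.1 hi).2]
        exact (not_le.1 hpos).trans_le (hmin' i (Finset.mem_sdiff.1 hi).1)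
      have e2 : core f S ((q t).erase ℓ') = core f S ((q t).erase ℓ' ∩ S ∪ core f S (q t)) := by
        simp only [core_congr hfg]
        exact core_erase_of_zero hg hz'
      rw [h, h'] at hSt1 ⊢
      rw [core_erase_of_zero hf hz, e2, hSt1, hc]

/-- Under the hypotheses of `IsPath.core_eq` the runs agree at every time at which the first one
has positive scores outside `S`. -/
lemma IsPath.eq_of_pos (hf : ∀ i, Monotone fun P => f P i) (hg : ∀ i, Monotone fun P => g P i)
    (hfg : ∀ P, ∀ i ∉ S, f P i = g P i)
    (htie : ∀ P, ∀ i ∉ S, ∀ l ∉ S, f P i = f P l → 0 < f P i → i = l)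
    {p q : ℕ → Finset V} {L : ℕ} (hp : IsPath f p L) (hq : IsPath g q L)
    (hS : ∀ t ≤ L, p t ∩ S = q t ∩ S) {t : ℕ} (ht : t ≤ L)
    (hpos : ∀ i ∈ p t \ S, 0 < f (p t) i) : p t = q t := by
  have hc := hp.core_eq hf hg hfg htie hq hS t ht
  have hA := (core_eq_iff hf).2 hpos
  have hcard : (p t \ S).card = (q t \ S).card := by
    have h1 := Finset.card_inter_add_card_sdiff (p t) S
    have h2 := Finset.card_inter_add_card_sdiff (q t) S
    rw [hp.card t ht] at h1
    rw [hq.card t ht] at h2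
    rw [hS t ht] at h1
    omega
  have hA' : core f S (q t) = q t \ S :=
    Finset.eq_of_subset_of_card_le core_subset (by rw [← hc, hA, hcard])
  rw [← Finset.sdiff_union_inter (p t) S, ← Finset.sdiff_union_inter (q t) S, ← hA, ← hA',
    hc, hS t ht]

end Paths

/-! ### Concentration for sums of Lipschitz functions of Gaussians -/

section Gaussian

lemma integrable_exp_mul_of_lipschitz {g : ℝ → ℝ} (hg : LipschitzWith 1 g) (t : ℝ) :
    Integrable (fun x => Real.exp (t * g x)) (gaussianReal 0 1) := by
  have h1 := integrable_exp_mul_gaussianReal (μ := 0) (v := 1) t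
  have h2 := integrable_exp_mul_gaussianReal (μ := 0) (v := 1) (-t)
  refine ((h1.add h2).const_mul (Real.exp (|t| * |g 0|))).mono'
    (by have := hg.continuous; fun_prop) (Eventually.of_forall fun x => ?_)
  rw [Real.norm_eq_abs, Real.abs_exp]
  have hx : |g x - g 0| ≤ |x| := by
    have := hg.dist_le_mul x 0
    simpa [Real.dist_eq] using this
  have h3 : t * g x ≤ |t| * |g 0| + |t * x| := by
    have h4 : |g x| ≤ |g 0| + |x| := by
      have := abs_sub_abs_le_abs_sub (g x) (g 0)
      linarith
    calc t * g x ≤ |t * g x| := le_abs_self _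
      _ = |t| * |g x| := abs_mul _ _
      _ ≤ |t| * (|g 0| + |x|) := by gcongr
      _ = _ := by rw [abs_mul]; ring
  have h5 : Real.exp |t * x| ≤ Real.exp (t * x) + Real.exp (-t * x) := by
    rcases abs_cases (t * x) with ⟨h, -⟩ | ⟨h, -⟩ <;> rw [h]
    · linarith [Real.exp_pos (-t * x)]
    · rw [neg_mul]; linarith [Real.exp_pos (t * x)]
  calc Real.exp (t * g x) ≤ Real.exp (|t| * |g 0| + |t * x|) := Real.exp_le_exp.2 h3
    _ = Real.exp (|t| * |g 0|) * Real.exp |t * x| := Real.exp_add _ _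
    _ ≤ _ := by
      simp only [Pi.add_apply]
      gcongr

lemma integrable_of_lipschitz {g : ℝ → ℝ} (hg : LipschitzWith 1 g) :
    Integrable g (gaussianReal 0 1) := by
  have hid : Integrable (fun x : ℝ => x) (gaussianReal 0 1) :=
    memLp_one_iff_integrable.1 (memLp_id_gaussianReal 1)
  refine ((integrable_const |g 0|).add hid.abs).mono'
    hg.continuous.aestronglyMeasurable (Eventually.of_forall fun x => ?_)
  have hx : |g x - g 0| ≤ |x| := by
    have := hg.dist_le_mul x 0
    simpa [Real.dist_eq] using this
  have := abs_sub_abs_le_abs_sub (g x) (g 0)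
  simp only [Pi.add_apply, Real.norm_eq_abs]
  linarith

/-- Symmetrization: `M(t) M(-t) ≤ exp (t ^ 2)` for the moment generating function of a `1`-Lipschitz
function of a standard Gaussian. -/
lemma mgf_mul_mgf_neg_le {g : ℝ → ℝ} (hg : LipschitzWith 1 g) (t : ℝ) :
    (∫ x, Real.exp (t * g x) ∂gaussianReal 0 1) * (∫ x, Real.exp (-t * g x) ∂gaussianReal 0 1)
      ≤ Real.exp (t ^ 2) := by
  -- With two independent copies, `M(t) M(-t)` is the mean of `cosh (t (h x - h y))`. Among
  -- `1`-Lipschitz `h` this is largest for the identity, where it is explicit.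
  have key : ∀ h : ℝ → ℝ, LipschitzWith 1 h → Integrable (fun z : ℝ × ℝ =>
      Real.exp (t * h z.1) * Real.exp (-t * h z.2) + Real.exp (-t * h z.1) * Real.exp (t * h z.2))
      ((gaussianReal 0 1).prod (gaussianReal 0 1)) ∧ ∫ z : ℝ × ℝ,
      (Real.exp (t * h z.1) * Real.exp (-t * h z.2) + Real.exp (-t * h z.1) * Real.exp (t * h z.2))
      ∂((gaussianReal 0 1).prod (gaussianReal 0 1)) =
      2 * ((∫ x, Real.exp (t * h x) ∂gaussianReal 0 1) *
        (∫ x, Real.exp (-t * h x) ∂gaussianReal 0 1)) := by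
    intro h hh
    have i1 := integrable_exp_mul_of_lipschitz hh t
    have i2 := integrable_exp_mul_of_lipschitz hh (-t)
    refine ⟨(i1.mul_prod i2).add (i2.mul_prod i1), ?_⟩
    rw [integral_add (i1.mul_prod i2) (i2.mul_prod i1),
      integral_prod_mul (fun x => Real.exp (t * h x)) (fun x => Real.exp (-t * h x)),
      integral_prod_mul (fun x => Real.exp (-t * h x)) (fun x => Real.exp (t * h x))]
    ring
  obtain ⟨ig, eg⟩ := key g hg
  obtain ⟨ii, ei⟩ := key id LipschitzWith.id
  have hle := integral_mono ig ii fun z => ?_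
  · rw [eg, ei] at hle
    have e : ∀ s : ℝ, ∫ x, Real.exp (s * x) ∂gaussianReal 0 1 = Real.exp (s ^ 2 / 2) := by
      intro s
      have := congrFun (mgf_id_gaussianReal (μ := 0) (v := 1)) s
      simpa [mgf] using this
    simp only [id, e] at hle
    rw [← Real.exp_add] at hle
    have : t ^ 2 / 2 + (-t) ^ 2 / 2 = t ^ 2 := by ring
    rw [this] at hle
    linarith
  · have e : ∀ a b : ℝ, Real.exp (t * a) * Real.exp (-t * b) + Real.exp (-t * a) * Real.exp (t * b)
        = 2 * Real.cosh (t * (a - b)) := by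
      intro a b
      rw [← Real.exp_add, ← Real.exp_add, Real.cosh_eq]
      ring_nf
    simp only [e, id]
    have hz : |g z.1 - g z.2| ≤ |z.1 - z.2| := by
      have := hg.dist_le_mul z.1 z.2
      simpa [Real.dist_eq] using this
    have : Real.cosh (t * (g z.1 - g z.2)) ≤ Real.cosh (t * (z.1 - z.2)) := by
      rw [Real.cosh_le_cosh, abs_mul, abs_mul]
      gcongr
    linarith

/-- For the centred function `1 + x ≤ exp x` gives `M(-t) ≥ 1`, so `M(t) ≤ M(t) M(-t) ≤ exp (t ^
2)`. The proxy `2` is not optimal and only affects constants. -/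
lemma hasSubgaussianMGF_of_lipschitz {g : ℝ → ℝ} (hg : LipschitzWith 1 g) :
    HasSubgaussianMGF (fun x => g x - ∫ y, g y ∂gaussianReal 0 1) 2 (gaussianReal 0 1) := by
  set m := ∫ y, g y ∂gaussianReal 0 1
  have hexp : ∀ t x : ℝ, Real.exp (t * (g x - m)) = Real.exp (-(t * m)) * Real.exp (t * g x) := by
    intro t x
    rw [← Real.exp_add]; ring_nf
  have hint : ∀ t, Integrable (fun x => Real.exp (t * (g x - m))) (gaussianReal 0 1) := by
    intro t
    simp only [hexp]
    exact (integrable_exp_mul_of_lipschitz hg t).const_mul _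
  refine ⟨hint, fun t => ?_⟩
  have hone : 1 ≤ ∫ x, Real.exp (-t * (g x - m)) ∂gaussianReal 0 1 := by
    have i0 : Integrable (fun x => -t * (g x - m)) (gaussianReal 0 1) :=
      ((integrable_of_lipschitz hg).sub (integrable_const m)).const_mul _
    have := integral_mono (i0.add (integrable_const 1)) (hint (-t))
      fun x => Real.add_one_le_exp _
    refine le_trans (le_of_eq ?_) this
    simp only [Pi.add_apply]
    rw [integral_add i0 (integrable_const 1), integral_const_mul,
      integral_sub (integrable_of_lipschitz hg) (integrable_const m)]
    simp [m]
  have hnn : 0 ≤ ∫ x, Real.exp (t * (g x - m)) ∂gaussianReal 0 1 :=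
    integral_nonneg fun x => (Real.exp_pos _).le
  have h2 := mgf_mul_mgf_neg_le hg t
  calc mgf (fun x => g x - m) (gaussianReal 0 1) t
      = ∫ x, Real.exp (t * (g x - m)) ∂gaussianReal 0 1 := rfl
    _ ≤ (∫ x, Real.exp (t * (g x - m)) ∂gaussianReal 0 1) *
        ∫ x, Real.exp (-t * (g x - m)) ∂gaussianReal 0 1 := le_mul_of_one_le_right hnn hone
    _ = (∫ x, Real.exp (t * g x) ∂gaussianReal 0 1) *
        ∫ x, Real.exp (-t * g x) ∂gaussianReal 0 1 := by
      simp only [hexp, integral_const_mul]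
      rw [mul_mul_mul_comm, ← Real.exp_add]
      simp
    _ ≤ Real.exp (t ^ 2) := h2
    _ = _ := by congr 1; push_cast; ring

variable {ι : Type*} [Fintype ι]

/-- The upper tail of a sum of `1`-Lipschitz functions of independent standard Gaussians. -/
lemma measure_sum_lipschitz_ge_le {g : ι → ℝ → ℝ} (hg : ∀ j, LipschitzWith 1 (g j))
    (J : Finset ι) {ε : ℝ} (hε : 0 ≤ ε) :
    (Measure.pi fun _ : ι => gaussianReal 0 1).real
      {W | ∑ j ∈ J, (∫ y, g j y ∂gaussianReal 0 1) + ε ≤ ∑ j ∈ J, g j (W j)}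
      ≤ Real.exp (-ε ^ 2 / (4 * J.card)) := by
  have hind : iIndepFun (fun j (W : ι → ℝ) => g j (W j) - ∫ y, g j y ∂gaussianReal 0 1)
      (Measure.pi fun _ : ι => gaussianReal 0 1) :=
    iIndepFun_pi (X := fun j x => g j x - ∫ y, g j y ∂gaussianReal 0 1)
      fun j => by have := (hg j).continuous; fun_prop
  have hsub : ∀ j ∈ J, HasSubgaussianMGF
      (fun W : ι → ℝ => g j (W j) - ∫ y, g j y ∂gaussianReal 0 1) 2
      (Measure.pi fun _ : ι => gaussianReal 0 1) := by
    intro j _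
    have hm := measurePreserving_eval (fun _ : ι => gaussianReal 0 1) j
    have h := hasSubgaussianMGF_of_lipschitz (hg j)
    rw [← hm.map_eq] at h
    have h' := HasSubgaussianMGF.of_map hm.measurable.aemeasurable h
    rw [hm.map_eq] at h'
    exact h'
  have h := HasSubgaussianMGF.measure_sum_ge_le_of_iIndepFun hind hsub hε
  refine le_trans (le_of_eq ?_) (h.trans (le_of_eq ?_))
  · congr 1
    ext W
    simp only [Set.mem_ofPred_eq, Finset.sum_sub_distrib]
    constructor <;> intro h <;> linarith
  · congr 2
    simp
    ring

/-- The lower tail of a sum of `1`-Lipschitz functions of independent standard Gaussians. -/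
lemma measure_sum_lipschitz_le_le {g : ι → ℝ → ℝ} (hg : ∀ j, LipschitzWith 1 (g j))
    (J : Finset ι) {ε : ℝ} (hε : 0 ≤ ε) :
    (Measure.pi fun _ : ι => gaussianReal 0 1).real
      {W | ∑ j ∈ J, g j (W j) + ε ≤ ∑ j ∈ J, (∫ y, g j y ∂gaussianReal 0 1)}
      ≤ Real.exp (-ε ^ 2 / (4 * J.card)) := by
  have h := measure_sum_lipschitz_ge_le (g := fun j x => -g j x) (fun j => (hg j).neg) J hε
  refine le_trans (le_of_eq ?_) h
  congr 1
  ext W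
  simp only [Set.mem_ofPred_eq, Finset.sum_neg_distrib, integral_neg]
  constructor <;> intro h <;> linarith

lemma lipschitzWith_max_add (a : ℝ) : LipschitzWith 1 fun x : ℝ => max (a + x) 0 := by
  have : LipschitzWith 1 fun x : ℝ => a + x := by
    apply LipschitzWith.of_dist_le_mul
    intro x y
    simp [Real.dist_eq]
  exact this.max_const 0

/-- The mean of the positive part of a standard Gaussian. -/
noncomputable def meanPosPart : ℝ := ∫ x, max x 0 ∂gaussianReal 0 1

lemma lipschitzWith_posPart : LipschitzWith 1 fun x : ℝ => max x 0 := by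
  simpa using lipschitzWith_max_add 0

lemma integral_comp_neg_gaussianReal (g : ℝ → ℝ) (hg : Continuous g) :
    ∫ x, g (-x) ∂gaussianReal 0 1 = ∫ x, g x ∂gaussianReal 0 1 := by
  have h : (gaussianReal 0 1).map (fun x => -x) = gaussianReal 0 1 := by
    rw [gaussianReal_map_neg, neg_zero]
  conv_rhs => rw [← h]
  rw [integral_map (by fun_prop) hg.aestronglyMeasurable]

lemma meanPosPart_pos : 0 < meanPosPart := by
  have h := integral_pos_iff_support_of_nonneg (μ := gaussianReal 0 1)
    (f := fun x : ℝ => max x 0) (fun x => le_max_right _ _)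
    (integrable_of_lipschitz lipschitzWith_posPart)
  rw [meanPosPart, h]
  have hs : (Function.support fun x : ℝ => max x 0) = Set.Ioi 0 := by
    ext x; simp
  rw [hs, pos_iff_ne_zero]
  intro h0
  have := gaussianReal_absolutelyContinuous' 0 (v := 1) one_ne_zero h0
  simp at this

/-- Pair `x` with `-x`: pointwise `max (a + x) 0 + max (a - x) 0 ≥ |x| + a`. Thus truncation keeps
at least half of the signal in the mean. -/
lemma meanPosPart_add_le {a : ℝ} (ha : 0 ≤ a) :
    meanPosPart + a / 2 ≤ ∫ x, max (a + x) 0 ∂gaussianReal 0 1 := by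
  have i1 := integrable_of_lipschitz lipschitzWith_posPart
  have i2 := integrable_of_lipschitz (lipschitzWith_max_add a)
  have i1' : Integrable (fun x : ℝ => max (-x) 0) (gaussianReal 0 1) :=
    integrable_of_lipschitz (by simpa [Function.comp_def] using lipschitzWith_posPart.comp LipschitzWith.id.neg)
  have i2' : Integrable (fun x : ℝ => max (a + -x) 0) (gaussianReal 0 1) :=
    integrable_of_lipschitz 
      (by simpa [Function.comp_def] using (lipschitzWith_max_add a).comp LipschitzWith.id.neg)
  have e1 := integral_comp_neg_gaussianReal (fun x => max x 0) (by fun_prop)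
  have e2 := integral_comp_neg_gaussianReal (fun x => max (a + x) 0) (by fun_prop)
  have h : ∫ x, (max x 0 + max (-x) 0 + a) ∂gaussianReal 0 1 ≤
      ∫ x, (max (a + x) 0 + max (a + -x) 0) ∂gaussianReal 0 1 :=
    integral_mono ((i1.add i1').add (integrable_const a)) (i2.add i2') fun x => by
    show max x 0 + max (-x) 0 + a ≤ max (a + x) 0 + max (a + -x) 0
    rcases max_cases x 0 with h1 | h1 <;> rcases max_cases (-x) 0 with h2 | h2 <;>
    rcases max_cases (a + x) 0 with h3 | h3 <;> rcases max_cases (a + -x) 0 with h4 | h4 <;>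
    linarith
  rw [integral_add (f := fun x : ℝ => max x 0 + max (-x) 0) (i1.add i1') (integrable_const a), integral_add i1 i1', integral_add i2 i2',
    e1, e2] at h
  simp at h
  rw [meanPosPart]
  linarith

end Gaussian

/-! ### Conditioning on part of the noise by resampling the rest -/

section Resampling

variable {ι : Type*}

open Classical in
/-- `resample D W W'` takes its entries in `D` from `W'` and the others from `W`. -/
noncomputable def resample (D : Set ι) (W W' : ι → ℝ) : ι → ℝ :=
  fun j => if j ∈ D then W' j else W j

lemma measurable_resample (D : Set ι) :
    Measurable fun z : (ι → ℝ) × (ι → ℝ) => resample D z.1 z.2 := by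
  classical
  refine measurable_pi_lambda _ fun j => ?_
  by_cases hj : j ∈ D <;> simp only [resample, hj, if_true, if_false] <;> fun_prop

lemma measurePreserving_resample [Fintype ι] (D : Set ι) (γ : Measure ℝ) [IsProbabilityMeasure γ] :
    MeasurePreserving (fun z : (ι → ℝ) × (ι → ℝ) => resample D z.1 z.2)
      ((Measure.pi fun _ : ι => γ).prod (Measure.pi fun _ : ι => γ)) (Measure.pi fun _ : ι => γ) := by
  classical
  refine ⟨measurable_resample D, ?_⟩
  symm
  refine Measure.pi_eq fun s hs => ?_
  rw [Measure.map_apply (measurable_resample D) (MeasurableSet.univ_pi hs)]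
  have : (fun z : (ι → ℝ) × (ι → ℝ) => resample D z.1 z.2) ⁻¹' Set.univ.pi s =
      (Set.univ.pi fun j => if j ∈ D then Set.univ else s j) ×ˢ
      (Set.univ.pi fun j => if j ∈ D then s j else Set.univ) := by
    ext z
    simp only [Set.mem_preimage, Set.mem_univ_pi, Set.mem_prod, resample, ← forall_and]
    refine forall_congr' fun j => ?_
    by_cases hj : j ∈ D <;> simp [hj]
  rw [this, Measure.prod_prod, Measure.pi_pi, Measure.pi_pi, ← Finset.prod_mul_distrib]
  refine Finset.prod_congr rfl fun j _ => ?_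
  by_cases hj : j ∈ D <;> simp [hj]

/-- If an event has conditional probability at most `ε` whatever the entries outside `D`, it has
probability at most `ε`. -/
lemma measure_le_of_resample [Fintype ι] (D : Set ι) (γ : Measure ℝ) [IsProbabilityMeasure γ]
    {B : Set (ι → ℝ)} (hB : MeasurableSet B) {ε : ENNReal}
    (h : ∀ W, (Measure.pi fun _ : ι => γ) {W' | resample D W W' ∈ B} ≤ ε) :
    (Measure.pi fun _ : ι => γ) B ≤ ε := by
  have hm := measurePreserving_resample D γ
  rw [← hm.measure_preimage hB.nullMeasurableSet,
    Measure.prod_apply (hm.measurable hB)]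
  calc _ ≤ ∫⁻ _, ε ∂(Measure.pi fun _ : ι => γ) := lintegral_mono fun W => h W
    _ = ε := by simp

end Resampling

open SparseTensorPCA

/-! ### Scores as sums over boxes of indices, and reduction to set-valued runs -/

section Scores

variable {n r : ℕ}

/-- The multi-indices `(i, j_1, …, j_{r-1})` with `j_1, …, j_{r-1} ∈ P`. -/
def box (r : ℕ) (P : Finset (Fin n)) (i : Fin n) : Finset (Fin r → Fin n) :=
  Fintype.piFinset fun m => if (m : ℕ) = 0 then {i} else P

/-- The score of `i` with respect to the set `P`. -/
def setScore (Q : Tensor n r) (P : Finset (Fin n)) (i : Fin n) : ℝ := ∑ j ∈ box r P i, Q j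

/-- The indicator vector of `P`. -/
def indicatorVec (P : Finset (Fin n)) : Fin n → ℝ := fun i => if i ∈ P then 1 else 0

lemma mem_box {P : Finset (Fin n)} {i : Fin n} {j : Fin r → Fin n} :
    j ∈ box r P i ↔ ∀ m : Fin r, if (m : ℕ) = 0 then j m = i else j m ∈ P := by
  simp only [box, Fintype.mem_piFinset]
  refine forall_congr' fun m => ?_
  split_ifs <;> simp

lemma head_of_mem_box {P : Finset (Fin n)} {i : Fin n} {j : Fin r → Fin n} (h : j ∈ box r P i)
    (hr : 0 < r) : j ⟨0, hr⟩ = i := by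
  simpa using mem_box.1 h ⟨0, hr⟩

lemma card_box (hr : 0 < r) (P : Finset (Fin n)) (i : Fin n) :
    (box r P i).card = P.card ^ (r - 1) := by
  obtain ⟨d, rfl⟩ : ∃ d, r = d + 1 := ⟨r - 1, by omega⟩
  simp [box, Fintype.card_piFinset, Fin.prod_univ_succ]

lemma box_mono {P P' : Finset (Fin n)} (h : P ⊆ P') (i : Fin n) : box r P i ⊆ box r P' i := by
  intro j hj
  rw [mem_box] at hj ⊢
  intro m
  have := hj m
  split_ifs at this ⊢ with h0
  · exact this
  · exact h this

/-- The first coordinate tells the boxes apart. Scores of distinct vertices therefore use disjoint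
sets of noise entries, even when each vertex has its own set `P i`. -/
lemma pairwiseDisjoint_box (hr : 0 < r) (A : Set (Fin n)) (P : Fin n → Finset (Fin n)) :
    A.PairwiseDisjoint fun i => box r (P i) i := by
  intro i _ l _ hil
  refine Finset.disjoint_left.2 fun j hj hj' => hil ?_
  rw [← head_of_mem_box hj hr, head_of_mem_box hj' hr]

lemma score_indicatorVec (Q : Tensor n r) (P : Finset (Fin n)) (i : Fin n) :
    score Q (indicatorVec P) i = setScore Q P i := by
  have h : ∀ j : Fin r → Fin n,
      rankOne (fun m : Fin r => if (m : ℕ) = 0 then Pi.single i 1 else indicatorVec P) j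
        = if j ∈ box r P i then 1 else 0 := by
    intro j
    have e : ∀ m : Fin r,
        (if (m : ℕ) = 0 then Pi.single i 1 else indicatorVec P : Fin n → ℝ) (j m)
          = if (if (m : ℕ) = 0 then j m = i else j m ∈ P) then 1 else 0 := by
      intro m
      by_cases hm : (m : ℕ) = 0 <;> simp [hm, indicatorVec, Pi.single_apply]
    simp only [rankOne, e, mem_box, Finset.mem_univ, true_imp_iff,
      Finset.prod_boole]
  simp [score, tensorInner, h, setScore, Finset.sum_ite_mem]

lemma setScore_mono {Q : Tensor n r} (hQ : ∀ j, 0 ≤ Q j) (i : Fin n) :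
    Monotone fun P => setScore Q P i := fun _ _ h =>
  Finset.sum_le_sum_of_subset_of_nonneg (box_mono h i) fun j _ _ => hQ j

lemma indicatorVec_eq_one {P : Finset (Fin n)} {i : Fin n} : indicatorVec P i = 1 ↔ i ∈ P := by
  simp [indicatorVec]

lemma update_indicatorVec (P : Finset (Fin n)) (ℓ : Fin n) :
    Function.update (indicatorVec P) ℓ 0 = indicatorVec (P.erase ℓ) := by
  ext i
  by_cases h : i = ℓ
  · subst h; simp [indicatorVec]
  · simp [h, indicatorVec]

lemma exists_path_of_mem_iterates {Q : Tensor n r} {t : ℕ} {σ : Fin n → ℝ}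
    (h : σ ∈ iterates Q t) : ∃ p, IsPath (setScore Q) p t ∧ σ = indicatorVec (p t) := by
  induction t generalizing σ with
  | zero =>
    refine ⟨fun _ => Finset.univ, ⟨rfl, fun t ht => absurd ht (Nat.not_lt_zero t)⟩, ?_⟩
    have h' : σ = fun _ => 1 := h
    ext i
    simp [indicatorVec, h']
  | succ t ih =>
    obtain ⟨P, hP, ℓ, hℓ, rfl⟩ := h
    obtain ⟨p, hp, rfl⟩ := ih hP
    refine ⟨fun s => if s ≤ t then p s else (p t).erase ℓ, ⟨by simpa using hp.1, ?_⟩, ?_⟩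
    · intro s hs
      have hs' : s ≤ t := by omega
      rcases hs'.lt_or_eq with hlt | rfl
      · simp only [hs', if_true, Nat.succ_le_of_lt hlt]
        exact hp.2 s hlt
      · simp only [le_refl, if_true, Nat.not_succ_le_self, if_false]
        refine ⟨ℓ, indicatorVec_eq_one.1 hℓ.1, fun i hi => ?_, rfl⟩
        have := hℓ.2 i (indicatorVec_eq_one.2 hi)
        rwa [score_indicatorVec, score_indicatorVec] at this
    · simp [update_indicatorVec]

lemma iterates_nonempty (Q : Tensor n r) {t : ℕ} (ht : t ≤ n) : (iterates Q t).Nonempty := by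
  induction t with
  | zero => exact ⟨_, rfl⟩
  | succ t ih =>
    obtain ⟨σ, hσ⟩ := ih (by omega)
    obtain ⟨p, hp, rfl⟩ := exists_path_of_mem_iterates hσ
    have hcard := hp.card t le_rfl
    rw [Fintype.card_fin] at hcard
    obtain ⟨ℓ, hℓ, hmin⟩ := Finset.exists_min_image (p t) (setScore Q (p t))
      (Finset.card_pos.1 (by omega))
    refine ⟨_, indicatorVec (p t), hσ, ℓ, ⟨indicatorVec_eq_one.2 hℓ, fun i hi => ?_⟩, rfl⟩
    rw [score_indicatorVec, score_indicatorVec]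
    exact hmin i (indicatorVec_eq_one.1 hi)

open Classical in
/-- The signal tensor: `μ` on the multi-indices with all coordinates in `S`, and `0` elsewhere. -/
noncomputable def signal (μ : ℝ) (S : Finset (Fin n)) (j : Fin r → Fin n) : ℝ :=
  if ∀ m, j m ∈ S then μ else 0

/-- The scores of greedy peeling when the signal has strength `μ` and support `S`. -/
noncomputable def peelScore (μ : ℝ) (S : Finset (Fin n)) (W : Tensor n r) (P : Finset (Fin n))
    (i : Fin n) : ℝ := setScore (fun j => max (signal μ S j + W j) 0) P i

lemma truncate_observation (k : ℕ) (lam : ℝ) (S : Finset (Fin n)) (W : Tensor n r) :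
    truncate (observation k lam (indicatorVec S) W) =
      fun j => max (signal (lam / (k : ℝ) ^ ((r : ℝ) / 2)) S j + W j) 0 := by
  classical
  ext j
  have : rankOne (fun _ : Fin r => indicatorVec S) j = if ∀ m, j m ∈ S then 1 else 0 := by
    simp only [rankOne, indicatorVec, Finset.prod_boole, Finset.mem_univ, true_imp_iff]
  simp only [truncate, observation, this, signal]
  split_ifs <;> simp

lemma hammingNorm_indicatorVec (P : Finset (Fin n)) : hammingNorm (indicatorVec P) = P.card := by
  rw [hammingNorm]
  congr 1
  ext i
  simp [indicatorVec]

lemma indicatorVec_dotProduct (P S : Finset (Fin n)) :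
    indicatorVec P ⬝ᵥ indicatorVec S = ((P ∩ S).card : ℝ) := by
  have : ∀ i, indicatorVec P i * indicatorVec S i = if i ∈ P ∩ S then 1 else 0 := by
    intro i
    by_cases h1 : i ∈ P <;> by_cases h2 : i ∈ S <;> simp [indicatorVec, h1, h2]
  simp only [dotProduct, this, Finset.sum_boole, Finset.filter_univ_mem]

/-- Greedy peeling succeeds if every run ends in a set that contains an eighth of the support. -/
lemma succeeds_of_paths {k : ℕ} (hk : 3 * k / 2 ≤ n) (lam : ℝ) (S : Finset (Fin n)) (W : Tensor n r)
    (h : ∀ p, IsPath (peelScore (lam / (k : ℝ) ^ ((r : ℝ) / 2)) S W) p (n - 3 * k / 2) →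
      k ≤ 8 * (p (n - 3 * k / 2) ∩ S).card) :
    Succeeds k (indicatorVec S) (observation k lam (indicatorVec S) W) := by
  refine ⟨iterates_nonempty _ (Nat.sub_le _ _), fun σ hσ => ?_⟩
  obtain ⟨p, hp, rfl⟩ := exists_path_of_mem_iterates hσ
  rw [truncate_observation] at hp
  refine ⟨fun i => ?_, ?_, ?_⟩
  · by_cases hi : i ∈ p (n - 3 * k / 2) <;> simp [indicatorVec, hi]
  · have hc := hp.card _ le_rfl
    rw [Fintype.card_fin] at hc
    rw [hammingNorm_indicatorVec]
    have : 2 * (p (n - 3 * k / 2)).card ≤ 3 * k := by omega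
    have : (2 : ℝ) * (p (n - 3 * k / 2)).card ≤ 3 * k := by exact_mod_cast this
    linarith
  · rw [indicatorVec_dotProduct]
    have := h p hp
    have : (k : ℝ) ≤ 8 * (p (n - 3 * k / 2) ∩ S).card := by exact_mod_cast this
    linarith

lemma peelScore_mono (μ : ℝ) (S : Finset (Fin n)) (W : Tensor n r) (i : Fin n) :
    Monotone fun P => peelScore μ S W P i := setScore_mono (fun _ => le_max_right _ _) i

lemma measurable_peelScore (μ : ℝ) (S P : Finset (Fin n)) (i : Fin n) :
    Measurable fun W : Tensor n r => peelScore μ S W P i := by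
  unfold peelScore setScore
  fun_prop

/-- Only the entries with first index `i` enter the score of `i`. This is what allows conditioning
on the rows outside the support. -/
lemma peelScore_congr {μ : ℝ} {S : Finset (Fin n)} {W W' : Tensor n r} (hr : 0 < r) {i : Fin n}
    (h : ∀ j : Fin r → Fin n, j ⟨0, hr⟩ = i → W j = W' j) (P : Finset (Fin n)) :
    peelScore μ S W P i = peelScore μ S W' P i := by
  refine Finset.sum_congr rfl fun j hj => ?_
  simp only [h j (head_of_mem_box hj hr)]

lemma sum_peelScore (hr : 0 < r) (μ : ℝ) (S A : Finset (Fin n)) (W : Tensor n r)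
    (P : Fin n → Finset (Fin n)) :
    ∑ i ∈ A, peelScore μ S W (P i) i =
      ∑ j ∈ A.biUnion fun i => box r (P i) i, max (signal μ S j + W j) 0 := by
  rw [Finset.sum_biUnion (pairwiseDisjoint_box hr _ P)]
  rfl

lemma card_biUnion_box (hr : 0 < r) (A : Finset (Fin n)) (P : Fin n → Finset (Fin n)) :
    (A.biUnion fun i => box r (P i) i).card = ∑ i ∈ A, (P i).card ^ (r - 1) := by
  rw [Finset.card_biUnion (pairwiseDisjoint_box hr _ P)]
  simp [card_box hr]

end Scores

/-! ### Tail bounds for fixed vertex sets, and absence of positive ties -/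

section Tails

variable {n r : ℕ}

/-- The law of a tensor with independent standard Gaussian entries. -/
noncomputable abbrev noise (n r : ℕ) : Measure (Tensor n r) :=
  Measure.pi fun _ : Fin r → Fin n => gaussianReal 0 1

lemma signal_nonneg {μ : ℝ} (hμ : 0 ≤ μ) (S : Finset (Fin n)) (j : Fin r → Fin n) :
    0 ≤ signal μ S j := by
  unfold signal; split_ifs <;> simp [hμ]

lemma meanPosPart_add_signal_le {μ : ℝ} (hμ : 0 ≤ μ) (S : Finset (Fin n)) (j : Fin r → Fin n) :
    meanPosPart + signal μ S j / 2 ≤ ∫ x, max (signal μ S j + x) 0 ∂gaussianReal 0 1 :=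
  meanPosPart_add_le (signal_nonneg hμ S j)

lemma exp_neg_mul_log {n : ℕ} (hn : 0 < n) (a : ℕ) :
    Real.exp (-(a * Real.log n)) = ((n : ℝ) ^ a)⁻¹ := by
  have : (0 : ℝ) < n := by exact_mod_cast hn
  rw [Real.exp_neg, mul_comm, Real.exp_mul, Real.exp_log this, Real.rpow_natCast]

/-- The scores outside the support do not exceed their mean by much on average. -/
lemma measure_sum_sdiff_ge_le (hr : 0 < r) (hn : 0 < n) (μ : ℝ) (S P : Finset (Fin n)) {R : ℝ}
    (hR0 : 0 ≤ R) (hR : R ^ 2 = 64 * ((n : ℝ) ^ (r - 1) * Real.log n)) (hP : P.Nonempty)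
    (hPS : P.card ≤ 3 * (P \ S).card) :
    (noise n r).real {W | ((P \ S).card : ℝ) * ((P.card : ℝ) ^ (r - 1) * meanPosPart + R) ≤
      ∑ i ∈ P \ S, peelScore μ S W P i} ≤ ((n : ℝ) ^ (5 * P.card))⁻¹ := by
  have hlog : 0 ≤ Real.log n := Real.log_natCast_nonneg n
  have h := measure_sum_lipschitz_ge_le (ι := Fin r → Fin n)
    (g := fun j x => max (signal μ S j + x) 0)
    (fun j => lipschitzWith_max_add _) ((P \ S).biUnion fun i => box r P i)
    (ε := (P \ S).card * R) (by positivity)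
  have hsig : ∀ j ∈ (P \ S).biUnion fun i => box r P i, signal μ S j = 0 := by
    intro j hj
    obtain ⟨i, hi, hji⟩ := Finset.mem_biUnion.1 hj
    rw [signal, if_neg]
    intro hall
    have := hall ⟨0, hr⟩
    rw [head_of_mem_box hji hr] at this
    exact (Finset.mem_sdiff.1 hi).2 this
  have hmean : ∑ j ∈ (P \ S).biUnion (fun i => box r P i),
      (∫ y, max (signal μ S j + y) 0 ∂gaussianReal 0 1) =
      (P \ S).card * ((P.card : ℝ) ^ (r - 1) * meanPosPart) := by
    rw [Finset.sum_congr rfl fun j hj => by rw [hsig j hj]]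
    simp only [zero_add, Finset.sum_const, nsmul_eq_mul]
    rw [card_biUnion_box hr (P \ S) fun _ => P, Finset.sum_const, smul_eq_mul]
    push_cast
    rw [meanPosPart]; ring
  have hpos : 0 < P.card := hP.card_pos
  have hpos' : 0 < (P \ S).card := by omega
  rw [hmean, card_biUnion_box hr (P \ S) fun _ => P, Finset.sum_const, smul_eq_mul] at h
  refine le_trans (le_of_eq ?_) (h.trans ?_)
  · congr 1
    ext W
    simp only [Set.mem_ofPred_eq]
    rw [sum_peelScore hr μ S (P \ S) W fun _ => P, mul_add]
  · rw [← exp_neg_mul_log hn, Real.exp_le_exp, neg_div, neg_le_neg_iff]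
    have hx : (0 : ℝ) < (P \ S).card := by exact_mod_cast hpos'
    have hy : (0 : ℝ) < P.card := by exact_mod_cast hpos
    have hyn : (P.card : ℝ) ≤ n := by
      exact_mod_cast (Finset.card_le_univ P).trans_eq (Fintype.card_fin n)
    have hxy : (P.card : ℝ) ≤ 3 * (P \ S).card := by exact_mod_cast hPS
    push_cast
    rw [le_div_iff₀ (by positivity), mul_pow, hR]
    have h1 : (P.card : ℝ) ^ (r - 1) ≤ (n : ℝ) ^ (r - 1) := by gcongr
    -- The choice of `R` makes the exponent at least `16 |P \ S| log n`, and `|P \ S| ≥ |P| / 3`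
    -- makes this at least `5 |P| log n`.
    calc 5 * (P.card : ℝ) * Real.log n * (4 * ((P \ S).card * (P.card : ℝ) ^ (r - 1)))
        ≤ 5 * (3 * (P \ S).card) * Real.log n * (4 * ((P \ S).card * (n : ℝ) ^ (r - 1))) := by
          gcongr
      _ = 60 * ((P \ S).card ^ 2 * ((n : ℝ) ^ (r - 1) * Real.log n)) := by ring
      _ ≤ 64 * ((P \ S).card ^ 2 * ((n : ℝ) ^ (r - 1) * Real.log n)) := by gcongr; norm_num
      _ = _ := by ring

/-- Few scores vanish simultaneously. -/
lemma measure_sum_nonpos_le (hr : 2 ≤ r) (hn : 0 < n) {μ : ℝ} (hμ : 0 ≤ μ) (S P A : Finset (Fin n))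
    (hP : P.Nonempty) {k : ℕ} (hk : 1 ≤ k) (hkA : k ≤ 4 * A.card)
    (hlog : 80 * Real.log n ≤ k * meanPosPart ^ 2) :
    (noise n r).real {W | ∑ i ∈ A, peelScore μ S W P i ≤ 0} ≤ ((n : ℝ) ^ (5 * P.card))⁻¹ := by
  have hr0 : 0 < r := by omega
  have he := meanPosPart_pos
  have hlog0 : 0 ≤ Real.log n := Real.log_natCast_nonneg n
  have h := measure_sum_lipschitz_le_le (ι := Fin r → Fin n)
    (g := fun j x => max (signal μ S j + x) 0)
    (fun j => lipschitzWith_max_add _) (A.biUnion fun i => box r P i)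
    (ε := A.card * (P.card : ℝ) ^ (r - 1) * meanPosPart) (by positivity)
  have hcard : (A.biUnion fun i => box r P i).card = A.card * P.card ^ (r - 1) := by
    rw [card_biUnion_box hr0 A fun _ => P, Finset.sum_const, smul_eq_mul]
  have hmean : A.card * (P.card : ℝ) ^ (r - 1) * meanPosPart ≤
      ∑ j ∈ A.biUnion (fun i => box r P i),
        (∫ y, max (signal μ S j + y) 0 ∂gaussianReal 0 1) := by
    have : ∑ j ∈ A.biUnion (fun i => box r P i), meanPosPart =
        A.card * (P.card : ℝ) ^ (r - 1) * meanPosPart := by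
      rw [Finset.sum_const, hcard, nsmul_eq_mul]; push_cast; ring
    rw [← this]
    refine Finset.sum_le_sum fun j _ => ?_
    have h1 := meanPosPart_add_signal_le hμ S j
    have h2 := signal_nonneg hμ S j
    linarith
  refine le_trans (measureReal_mono fun W hW => ?_) (h.trans ?_)
  · simp only [Set.mem_ofPred_eq] at hW ⊢
    rw [sum_peelScore hr0 μ S A W fun _ => P] at hW
    linarith
  · rw [← exp_neg_mul_log hn, Real.exp_le_exp, neg_div, neg_le_neg_iff, hcard]
    have hA : 0 < A.card := by omega
    have hx : (0 : ℝ) < A.card := by exact_mod_cast hA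
    have hy : (1 : ℝ) ≤ P.card := by exact_mod_cast hP.card_pos
    have hkA' : (k : ℝ) ≤ 4 * A.card := by exact_mod_cast hkA
    -- `r ≥ 2` is needed here: the exponent must grow at least linearly in `|P|` to pay for a union
    -- over all `P`.
    have h1 : (P.card : ℝ) ≤ (P.card : ℝ) ^ (r - 1) := by
      calc (P.card : ℝ) = (P.card : ℝ) ^ 1 := (pow_one _).symm
        _ ≤ _ := pow_le_pow_right₀ hy (by omega)
    push_cast
    rw [le_div_iff₀ (by positivity)]
    have h3 : 20 * Real.log n ≤ A.card * meanPosPart ^ 2 := by nlinarith [sq_nonneg meanPosPart]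
    calc 5 * (P.card : ℝ) * Real.log n * (4 * (A.card * (P.card : ℝ) ^ (r - 1)))
        = (P.card : ℝ) * (20 * Real.log n) * (A.card * (P.card : ℝ) ^ (r - 1)) := by ring
      _ ≤ (P.card : ℝ) ^ (r - 1) * (A.card * meanPosPart ^ 2) *
          (A.card * (P.card : ℝ) ^ (r - 1)) := by gcongr
      _ = _ := by ring

/-- For given vertex sets, the scores of many vertices of the support are unlikely to be all
small. -/
lemma measure_forall_le_le (hr : 0 < r) (hn : 0 < n) {μ : ℝ} (hμ : 0 ≤ μ) (S A : Finset (Fin n))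
    (hAS : A ⊆ S) {R : ℝ} (hR0 : 0 ≤ R) (hR : R ^ 2 = 64 * ((n : ℝ) ^ (r - 1) * Real.log n))
    {k : ℕ} (hk : 1 ≤ k) (hA : A.Nonempty)
    (hsnr : 4 * R * 8 ^ (r - 1) ≤ μ * (k : ℝ) ^ (r - 1)) (P : Fin n → Finset (Fin n)) :
    (noise n r).real {W | ∀ i ∈ A, k ≤ 8 * (P i ∩ S).card ∧
      peelScore μ S W (P i) i ≤ ((P i).card : ℝ) ^ (r - 1) * meanPosPart + R} ≤
      ((n : ℝ) ^ (16 * A.card))⁻¹ := by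
  have hlog0 : 0 ≤ Real.log n := Real.log_natCast_nonneg n
  -- The sets `P i` are fixed, so this condition is not random: if it fails, the event is empty.
  by_cases hPk : ∀ i ∈ A, k ≤ 8 * (P i ∩ S).card
  swap
  · have : {W : Tensor n r | ∀ i ∈ A, k ≤ 8 * (P i ∩ S).card ∧
        peelScore μ S W (P i) i ≤ ((P i).card : ℝ) ^ (r - 1) * meanPosPart + R} = ∅ := by
      ext W
      simp only [Set.mem_ofPred_eq, Set.mem_empty_iff_false, iff_false]
      exact fun h => hPk fun i hi => (h i hi).1
    rw [this]
    simp
  have h := measure_sum_lipschitz_le_le (ι := Fin r → Fin n)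
    (g := fun j x => max (signal μ S j + x) 0)
    (fun j => lipschitzWith_max_add _) (A.biUnion fun i => box r (P i) i)
    (ε := A.card * R) (by positivity)
  have hmean : ∑ i ∈ A, (((P i).card : ℝ) ^ (r - 1) * meanPosPart + 2 * R) ≤
      ∑ j ∈ A.biUnion (fun i => box r (P i) i),
        (∫ y, max (signal μ S j + y) 0 ∂gaussianReal 0 1) := by
    rw [Finset.sum_biUnion (pairwiseDisjoint_box hr _ P)]
    refine Finset.sum_le_sum fun i hi => ?_
    -- At least `(k / 8) ^ (r-1)` entries carry signal, each raising the mean by `μ / 2`. The total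
    -- `2 * R` leaves a deviation of `R` per vertex below the mean.
    have h1 : 2 * R ≤ ∑ j ∈ box r (P i) i, signal μ S j / 2 := by
      have hsub : ∑ j ∈ box r (P i ∩ S) i, μ / 2 ≤ ∑ j ∈ box r (P i) i, signal μ S j / 2 := by
        refine le_trans (Finset.sum_le_sum fun j hj => ?_)
          (Finset.sum_le_sum_of_subset_of_nonneg (box_mono Finset.inter_subset_left i)
            fun j _ _ => by have := signal_nonneg hμ S j; linarith)
        rw [signal, if_pos]
        intro m
        have := mem_box.1 hj m
        split_ifs at this with h0
        · rw [this]; exact hAS hi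
        · exact (Finset.mem_inter.1 this).2
      refine le_trans ?_ hsub
      rw [Finset.sum_const, card_box hr, nsmul_eq_mul]
      have h8 : (k : ℝ) ≤ 8 * ((P i ∩ S).card : ℝ) := by exact_mod_cast hPk i hi
      have h9 : μ * (k : ℝ) ^ (r - 1) ≤ μ * (8 ^ (r - 1) * ((P i ∩ S).card : ℝ) ^ (r - 1)) := by
        rw [← mul_pow]; gcongr
      have h10 := hsnr.trans h9
      have h11 : (0 : ℝ) < 8 ^ (r - 1) := by positivity
      have h12 : 4 * R ≤ μ * ((P i ∩ S).card : ℝ) ^ (r - 1) := by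
        refine le_of_mul_le_mul_right ?_ h11
        linarith
      push_cast
      linarith
    calc ((P i).card : ℝ) ^ (r - 1) * meanPosPart + 2 * R
        ≤ ∑ j ∈ box r (P i) i, (meanPosPart + signal μ S j / 2) := by
          rw [Finset.sum_add_distrib, Finset.sum_const, card_box hr, nsmul_eq_mul]
          push_cast
          linarith
      _ ≤ _ := Finset.sum_le_sum fun j _ => meanPosPart_add_signal_le hμ S j
  refine le_trans (measureReal_mono fun W hW => ?_) (h.trans ?_)
  · simp only [Set.mem_ofPred_eq] at hW ⊢
    have h1 := Finset.sum_le_sum fun i hi => (hW i hi).2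
    rw [sum_peelScore hr μ S A W P] at h1
    refine le_trans ?_ hmean
    rw [Finset.sum_add_distrib, Finset.sum_const, nsmul_eq_mul] at h1 ⊢
    linarith
  · rw [← exp_neg_mul_log hn, Real.exp_le_exp, neg_div, neg_le_neg_iff, card_biUnion_box hr]
    have hx : (0 : ℝ) < A.card := by exact_mod_cast hA.card_pos
    have hpos : (0 : ℝ) < ∑ i ∈ A, ((P i).card : ℝ) ^ (r - 1) := by
      refine Finset.sum_pos (fun i hi => ?_) hA
      have h1 := hPk i hi
      have h2 := Finset.card_le_card (Finset.inter_subset_left : P i ∩ S ⊆ P i)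
      have : 0 < (P i).card := by omega
      positivity
    have hle : ∑ i ∈ A, ((P i).card : ℝ) ^ (r - 1) ≤ A.card * (n : ℝ) ^ (r - 1) := by
      rw [← nsmul_eq_mul]
      refine Finset.sum_le_card_nsmul _ _ _ fun i _ => ?_
      have : ((P i).card : ℝ) ≤ n := by
        exact_mod_cast (Finset.card_le_univ (P i)).trans_eq (Fintype.card_fin n)
      gcongr
    push_cast
    rw [le_div_iff₀ (by positivity), mul_pow, hR]
    calc 16 * (A.card : ℝ) * Real.log n * (4 * ∑ i ∈ A, ((P i).card : ℝ) ^ (r - 1))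
        ≤ 16 * (A.card : ℝ) * Real.log n * (4 * (A.card * (n : ℝ) ^ (r - 1))) := by gcongr
      _ = _ := by ring

/-- Almost surely, distinct vertices have distinct scores unless these
vanish. -/
lemma measure_tie_eq_zero (hr : 0 < r) (μ : ℝ) (S P : Finset (Fin n)) {i l : Fin n} (hil : i ≠ l) :
    noise n r {W | peelScore μ S W P i = peelScore μ S W P l ∧ 0 < peelScore μ S W P i} = 0 := by
  classical
  -- A positive score contains a positive entry `j`. On `B j`, with the other entries frozen, the
  -- score of `i` is `W j` plus a constant while that of `l` does not involve `W j`, so a tie pins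
  -- `W j` to one value.
  set B : (Fin r → Fin n) → Set (Tensor n r) := fun j =>
    {W | peelScore μ S W P i = peelScore μ S W P l ∧ 0 < signal μ S j + W j} with hBdef
  have hsub : {W : Tensor n r | peelScore μ S W P i = peelScore μ S W P l ∧
      0 < peelScore μ S W P i} ⊆ ⋃ j ∈ box r P i, B j := by
    rintro W ⟨h1, h2⟩
    obtain ⟨j, hj, hpos⟩ := Finset.exists_lt_of_sum_lt (s := box r P i) (f := fun _ => (0 : ℝ))
      (g := fun j => max (signal μ S j + W j) 0) (by rw [Finset.sum_const_zero]; exact h2)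
    simp only [Set.mem_iUnion]
    exact ⟨j, hj, h1, by simpa using hpos⟩
  refine measure_mono_null hsub ((measure_biUnion_null_iff (Finset.countable_toSet _)).2 ?_)
  intro j hj
  have hj : j ∈ box r P i := hj
  have hBm : MeasurableSet (B j) :=
    (measurableSet_eq_fun (measurable_peelScore μ S P i) (measurable_peelScore μ S P l)).inter
      (measurableSet_lt measurable_const (measurable_const.add (measurable_pi_apply j)))
  refine le_antisymm (measure_le_of_resample {j} (gaussianReal 0 1) hBm fun W => ?_) zero_le
  obtain ⟨c, hc⟩ : ∃ c : ℝ, ∀ W', resample {j} W W' ∈ B j → W' j = c := by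
    refine ⟨peelScore μ S W P l - ∑ j' ∈ (box r P i).erase j, max (signal μ S j' + W j') 0
      - signal μ S j, ?_⟩
    rintro W' ⟨h1, h2⟩
    have hl : peelScore μ S (resample {j} W W') P l = peelScore μ S W P l := by
      refine peelScore_congr hr (fun j' hj' => ?_) P
      have : j' ∉ ({j} : Set (Fin r → Fin n)) := by
        rintro rfl
        exact hil ((head_of_mem_box hj hr).symm.trans hj')
      simp [resample, this]
    have hi : peelScore μ S (resample {j} W W') P i = signal μ S j + W' j +
        ∑ j' ∈ (box r P i).erase j, max (signal μ S j' + W j') 0 := by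
      rw [peelScore, setScore, ← Finset.add_sum_erase _ _ hj]
      congr 1
      · rw [max_eq_left h2.le]; simp [resample]
      · refine Finset.sum_congr rfl fun j' hj' => ?_
        have : j' ∉ ({j} : Set (Fin r → Fin n)) := by
          simpa using (Finset.mem_erase.1 hj').1
        simp [resample, this]
    linarith
  have hnull : noise n r ((fun W' : Tensor n r => W' j) ⁻¹' {c}) = 0 := by
    have := (measurePreserving_eval (fun _ : Fin r → Fin n => gaussianReal 0 1) j).measure_preimage
      (MeasurableSet.singleton c).nullMeasurableSet
    have hna := nullSingletonClass_gaussianReal (μ := 0) (v := 1) one_ne_zero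
    exact this.trans (measure_singleton c)
  exact (measure_mono fun W' hW' => hc W' hW').trans hnull.le

end Tails

/-! ### Exceptional events, their probabilities, and success outside them -/

section Events

variable {n r : ℕ}

/-- Extends a finite sequence of vertex sets to all times. -/
def extend (q : Fin (n + 1) → Finset (Fin n)) (t : ℕ) : Finset (Fin n) :=
  q ⟨min t n, Nat.lt_succ_of_le (min_le_right t n)⟩

/-- Two vertices outside `S` have the same positive score. -/
def HasTie (μ : ℝ) (S : Finset (Fin n)) (W : Tensor n r) : Prop :=
  ∃ P : Finset (Fin n), ∃ i ∉ S, ∃ l ∉ S, i ≠ l ∧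
    peelScore μ S W P i = peelScore μ S W P l ∧ 0 < peelScore μ S W P i

/-- The vertex `i` leaves the run `p` before time `L`, when the score of every vertex outside `S` is
positive, its own score is not much above `m ^ (r - 1) * meanPosPart`, where `m` is the number of
remaining vertices, and an eighth of the support remains. -/
def LeavesLow (μ : ℝ) (S : Finset (Fin n)) (k : ℕ) (R : ℝ) (W : Tensor n r)
    (p : ℕ → Finset (Fin n)) (L : ℕ) (i : Fin n) : Prop :=
  ∃ t < L, i ∈ p t ∧ i ∉ p (t + 1) ∧ (∀ l ∈ p t \ S, 0 < peelScore μ S W (p t) l) ∧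
    k ≤ 8 * (p t ∩ S).card ∧
    peelScore μ S W (p t) i ≤ ((p t).card : ℝ) ^ (r - 1) * meanPosPart + R

/-- There are no ties, and yet half of the support leaves some run with low scores. -/
def HasLowRun (μ : ℝ) (S : Finset (Fin n)) (k : ℕ) (R : ℝ) (W : Tensor n r) : Prop :=
  -- Runs are indexed by `Fin (n + 1)` so that this quantifier is over a finite type, which gives
  -- measurability. Ties are excluded inside the event because the sets are determined only without
  -- them.
  ¬ HasTie μ S W ∧ ∃ (q : Fin (n + 1) → Finset (Fin n)) (L : Fin (n + 1)) (A : Finset (Fin n)),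
    IsPath (peelScore μ S W) (extend q) L ∧ A ⊆ S ∧ k ≤ 2 * A.card ∧
    ∀ i ∈ A, LeavesLow μ S k R W (extend q) L i

lemma extend_of_le (q : ℕ → Finset (Fin n)) {t : ℕ} (ht : t ≤ n) :
    extend (fun s : Fin (n + 1) => q s) t = q t := by
  simp [extend, ht]

lemma measurable_hasTie (μ : ℝ) (S : Finset (Fin n)) :
    Measurable fun W : Tensor n r => HasTie μ S W := by
  have hm := fun P i => measurable_peelScore (r := r) μ S P i
  exact Measurable.exists fun P => Measurable.exists fun i => measurable_const.and <|
    Measurable.exists fun l => measurable_const.and <| measurable_const.and <|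
    (measurableSet_setOfPred.1 (measurableSet_eq_fun (hm P i) (hm P l))).and
      (measurableSet_setOfPred.1 (measurableSet_lt measurable_const (hm P i)))

lemma measurable_isPath (μ : ℝ) (S : Finset (Fin n)) (p : ℕ → Finset (Fin n)) (L : ℕ) :
    Measurable fun W : Tensor n r => IsPath (peelScore μ S W) p L := by
  have hm := fun P i => measurable_peelScore (r := r) μ S P i
  exact measurable_const.and <| Measurable.forall fun t => measurable_const.imp <|
    Measurable.exists fun ℓ => measurable_const.and <| (Measurable.forall fun i =>
      measurable_const.imp (measurableSet_setOfPred.1 (measurableSet_le (hm _ _) (hm _ _)))).and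
      measurable_const

lemma measurable_leavesLow (μ : ℝ) (S : Finset (Fin n)) (k : ℕ) (R : ℝ)
    (p : ℕ → Finset (Fin n)) (L : ℕ) (i : Fin n) :
    Measurable fun W : Tensor n r => LeavesLow μ S k R W p L i := by
  have hm := fun P i => measurable_peelScore (r := r) μ S P i
  exact Measurable.exists fun t => measurable_const.and <| measurable_const.and <|
    measurable_const.and <| (Measurable.forall fun l => measurable_const.imp
      (measurableSet_setOfPred.1 (measurableSet_lt measurable_const (hm _ _)))).and <|
    measurable_const.and (measurableSet_setOfPred.1 (measurableSet_le (hm _ _) measurable_const))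

lemma measurableSet_hasLowRun (μ : ℝ) (S : Finset (Fin n)) (k : ℕ) (R : ℝ) :
    MeasurableSet {W : Tensor n r | HasLowRun μ S k R W} :=
  measurableSet_setOfPred.2 <| (measurable_hasTie μ S).not.and <| Measurable.exists fun _ =>
    Measurable.exists fun _ => Measurable.exists fun _ =>
    (measurable_isPath μ S _ _).and <| measurable_const.and <| measurable_const.and <|
    Measurable.forall fun i => measurable_const.imp (measurable_leavesLow μ S k R _ _ i)

lemma measure_hasTie (hr : 0 < r) (μ : ℝ) (S : Finset (Fin n)) :
    noise n r {W | HasTie μ S W} = 0 := by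
  have hsub : {W : Tensor n r | HasTie μ S W} ⊆ ⋃ (P : Finset (Fin n)) (i : Fin n) (l : Fin n)
      (_ : i ≠ l), {W | peelScore μ S W P i = peelScore μ S W P l ∧ 0 < peelScore μ S W P i} := by
    rintro W ⟨P, i, -, l, -, hil, h⟩
    simp only [Set.mem_iUnion]
    exact ⟨P, i, l, hil, h⟩
  refine measure_mono_null hsub ?_
  simp only [measure_iUnion_null_iff]
  exact fun P i l hil => measure_tie_eq_zero hr μ S P hil

/-- The sets of a run decrease, so membership of `i` holds up to a last time `τ`. A vertex that is
never removed gets `τ = L`. -/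
lemma IsPath.exists_removalTime {V : Type*} [Fintype V] [DecidableEq V] {f : Finset V → V → ℝ}
    {p : ℕ → Finset V} {L : ℕ} (hp : IsPath f p L) (i : V) :
    ∃ τ ≤ L, ∀ t ≤ L, i ∈ p t ↔ t ≤ τ := by
  refine ⟨Nat.findGreatest (fun t => i ∈ p t) L, Nat.findGreatest_le _, fun t ht =>
    ⟨fun h => Nat.le_findGreatest ht h, fun h => ?_⟩⟩
  have h0 : i ∈ p 0 := by rw [hp.1]; exact Finset.mem_univ i
  exact hp.subset h (Nat.findGreatest_le _)
    (Nat.findGreatest_spec (P := fun t => i ∈ p t) (Nat.zero_le L) h0)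

/-- Given the rows outside the support, the times at which the vertices of the support leave
determine the sets that these vertices leave with low scores. -/
lemma exists_determined_sets (hr : 0 < r) (μ : ℝ) (S : Finset (Fin n)) (W : Tensor n r) (L : ℕ)
    (τ : Fin n → ℕ) : ∃ P : Fin n → Finset (Fin n), ∀ (W' : Tensor n r) (p : ℕ → Finset (Fin n)),
      ¬ HasTie μ S (resample {j | j ⟨0, hr⟩ ∈ S} W W') →
      IsPath (peelScore μ S (resample {j | j ⟨0, hr⟩ ∈ S} W W')) p L →
      (∀ t ≤ L, ∀ i ∈ S, i ∈ p t ↔ t ≤ τ i) → ∀ i, τ i ≤ L →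
      (∀ l ∈ p (τ i) \ S, 0 < peelScore μ S (resample {j | j ⟨0, hr⟩ ∈ S} W W') (p (τ i)) l) →
      p (τ i) = P i := by
  set D : Set (Fin r → Fin n) := {j | j ⟨0, hr⟩ ∈ S}
  -- Any one run with these removal times serves as the reference: the scores outside `S` come from
  -- `W` alone, so `IsPath.eq_of_pos` applies to every other such run. If there is none, the claim
  -- is vacuous.
  by_cases hex : ∃ (W' : Tensor n r) (p : ℕ → Finset (Fin n)),
      IsPath (peelScore μ S (resample D W W')) p L ∧ ∀ t ≤ L, ∀ i ∈ S, i ∈ p t ↔ t ≤ τ i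
  · obtain ⟨W₁, q, hq, hqτ⟩ := hex
    refine ⟨fun i => q (τ i), fun W' p htie hp hpτ i hi hpos => ?_⟩
    refine IsPath.eq_of_pos (peelScore_mono μ S _) (peelScore_mono μ S _) ?_ ?_ hp hq ?_ hi hpos
    · intro P i hiS
      refine peelScore_congr hr (fun j hj => ?_) P
      have : j ∉ D := fun h => hiS (hj ▸ h)
      simp [resample, this]
    · intro P i hi l hl h h0
      by_contra hne
      exact htie ⟨P, i, hi, l, hl, hne, h, h0⟩
    · intro t ht
      ext i
      simp only [Finset.mem_inter]
      constructor
      · exact fun h => ⟨(hqτ t ht i h.2).2 ((hpτ t ht i h.2).1 h.1), h.2⟩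
      · exact fun h => ⟨(hpτ t ht i h.2).2 ((hqτ t ht i h.2).1 h.1), h.2⟩
  · exact ⟨fun _ => ∅, fun W' p _ hp hpτ => absurd ⟨W', p, hp, hpτ⟩ hex⟩

/-- The factor `(n + 1) ^ (k + 1)` counts the length `L` and the `k` removal times, and `2 ^ k` the
subsets `A` of the support. The last factor is the bound for one choice, from `16 |A| ≥ 8 k`. -/
lemma union_bound_arith {n k : ℕ} (hn : 2 ≤ n) (hk : 1 ≤ k) :
    ((n : ℝ) + 1) ^ (k + 1) * 2 ^ k * ((n : ℝ) ^ (8 * k))⁻¹ ≤ 1 / n := by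
  have hn' : (0 : ℝ) < n := by positivity
  rw [← div_eq_mul_inv, div_le_div_iff₀ (by positivity) hn', one_mul]
  have h : (n + 1) ^ (k + 1) * 2 ^ k * n ≤ n ^ (8 * k) := by
    calc (n + 1) ^ (k + 1) * 2 ^ k * n ≤ (n ^ 2) ^ (k + 1) * n ^ k * n := by
          gcongr
          nlinarith
      _ = n ^ (2 * (k + 1) + k + 1) := by ring
      _ ≤ n ^ (8 * k) := Nat.pow_le_pow_right (by omega) (by omega)
  exact_mod_cast h

lemma measure_hasLowRun_le (hr : 0 < r) (hn : 2 ≤ n) {μ : ℝ} (hμ : 0 ≤ μ) (S : Finset (Fin n))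
    {R : ℝ} (hR0 : 0 ≤ R) (hR : R ^ 2 = 64 * ((n : ℝ) ^ (r - 1) * Real.log n))
    {k : ℕ} (hk : 1 ≤ k) (hS : S.card = k)
    (hsnr : 4 * R * 8 ^ (r - 1) ≤ μ * (k : ℝ) ^ (r - 1)) :
    noise n r {W | HasLowRun μ S k R W} ≤ ENNReal.ofReal (1 / n) := by
  classical
  refine measure_le_of_resample {j | j ⟨0, hr⟩ ∈ S} (gaussianReal 0 1)
    (measurableSet_hasLowRun μ S k R) fun W => ?_
  set D : Set (Fin r → Fin n) := {j | j ⟨0, hr⟩ ∈ S}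
  let time : (S → Fin (n + 1)) → Fin n → ℕ := fun τ i => if hi : i ∈ S then τ ⟨i, hi⟩ else 0
  choose P hP using fun x : Fin (n + 1) × (S → Fin (n + 1)) =>
    exists_determined_sets hr μ S W x.1 (time x.2)
  let F : Finset (Finset (Fin n)) := S.powerset.filter fun A => k ≤ 2 * A.card
  have hsub : {W' | resample D W W' ∈ {W : Tensor n r | HasLowRun μ S k R W}} ⊆
      ⋃ x ∈ (Finset.univ : Finset (Fin (n + 1) × (S → Fin (n + 1)))), ⋃ A ∈ F,
        {W' | ∀ i ∈ A, k ≤ 8 * (P x i ∩ S).card ∧ peelScore μ S W' (P x i) i ≤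
          ((P x i).card : ℝ) ^ (r - 1) * meanPosPart + R} := by
    rintro W' ⟨htie, q, L, A, hpath, hAS, hkA, hlow⟩
    have hLn : (L : ℕ) ≤ n := by have := L.2; omega
    choose τ hτL hτ using fun i => hpath.exists_removalTime i
    let x : Fin (n + 1) × (S → Fin (n + 1)) :=
      (L, fun i => ⟨τ i, Nat.lt_succ_of_le ((hτL i).trans hLn)⟩)
    have htime : ∀ i ∈ S, time x.2 i = τ i := by
      intro i hi
      simp [time, x, hi]
    simp only [Set.mem_iUnion]
    refine ⟨x, Finset.mem_univ _, A, Finset.mem_filter.2 ⟨Finset.mem_powerset.2 hAS, hkA⟩, ?_⟩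
    intro i hi
    obtain ⟨t, htL, hit, hit1, hpos, hkt, hle⟩ := hlow i hi
    have hiS := hAS hi
    have hti : t = time x.2 i := by
      rw [htime i hiS]
      have h1 := (hτ i t htL.le).1 hit
      have h2 : ¬ (t + 1 ≤ τ i) := fun h => hit1 ((hτ i (t + 1) htL).2 h)
      omega
    have hPx : extend q t = P x i := by
      rw [hti]
      refine hP x W' (extend q) htie hpath (fun s hs l hl => ?_) i ?_ ?_
      · rw [htime l hl]; exact hτ l s hs
      · rw [← hti]; exact htL.le
      · rw [← hti]; exact hpos
    rw [hPx] at hkt hle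
    -- For `i ∈ S` the score reads only resampled rows, so `W` drops out and fixed sets face fresh
    -- noise `W'`.
    refine ⟨hkt, le_trans (le_of_eq ?_) hle⟩
    refine peelScore_congr hr (fun j hj => ?_) _
    have : j ∈ D := show j ⟨0, hr⟩ ∈ S from hj ▸ hiS
    simp [resample, this]
  have hreal : (noise n r).real {W' | resample D W W' ∈ {W : Tensor n r | HasLowRun μ S k R W}} ≤
      1 / n := by
    refine (measureReal_mono hsub (measure_ne_top _ _)).trans ?_
    refine (measureReal_biUnion_finset_le _ _).trans ?_
    have hA : ∀ x, (noise n r).real (⋃ A ∈ F, {W' | ∀ i ∈ A, k ≤ 8 * (P x i ∩ S).card ∧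
        peelScore μ S W' (P x i) i ≤ ((P x i).card : ℝ) ^ (r - 1) * meanPosPart + R}) ≤
        2 ^ k * ((n : ℝ) ^ (8 * k))⁻¹ := by
      intro x
      refine (measureReal_biUnion_finset_le _ _).trans ?_
      calc _ ≤ ∑ A ∈ F, ((n : ℝ) ^ (8 * k))⁻¹ := by
            refine Finset.sum_le_sum fun A hA => ?_
            obtain ⟨hAS, hkA⟩ := Finset.mem_filter.1 hA
            refine (measure_forall_le_le hr (by omega) hμ S A (Finset.mem_powerset.1 hAS) hR0 hR hk
              (Finset.card_pos.1 (by omega)) hsnr (P x)).trans ?_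
            have h1 : (1 : ℝ) ≤ n := by exact_mod_cast (by omega : 1 ≤ n)
            exact inv_anti₀ (by positivity) (pow_le_pow_right₀ h1 (by omega))
        _ = F.card * ((n : ℝ) ^ (8 * k))⁻¹ := by simp
        _ ≤ 2 ^ k * ((n : ℝ) ^ (8 * k))⁻¹ := by
            gcongr
            have := Finset.card_filter_le S.powerset fun A => k ≤ 2 * A.card
            rw [Finset.card_powerset, hS] at this
            exact_mod_cast this
    refine (Finset.sum_le_sum fun x _ => hA x).trans ?_
    refine le_trans (le_of_eq ?_) (union_bound_arith hn hk)
    rw [Finset.sum_const, Finset.card_univ, Fintype.card_prod, Fintype.card_fun, Fintype.card_fin,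
      Fintype.card_coe, hS, nsmul_eq_mul]
    push_cast
    ring
  rw [← ofReal_measureReal]
  exact ENNReal.ofReal_le_ofReal hreal

/-- The scores outside the support are large on average. -/
def HasHighMean (μ : ℝ) (S : Finset (Fin n)) (R : ℝ) (W : Tensor n r) : Prop :=
  ∃ P : Finset (Fin n), P.Nonempty ∧ P.card ≤ 3 * (P \ S).card ∧
    ((P \ S).card : ℝ) * ((P.card : ℝ) ^ (r - 1) * meanPosPart + R) ≤
      ∑ i ∈ P \ S, peelScore μ S W P i

/-- A quarter of the scores in the support vanish. -/
def HasManyZeros (μ : ℝ) (S : Finset (Fin n)) (W : Tensor n r) : Prop :=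
  ∃ P A : Finset (Fin n), P.Nonempty ∧ S.card ≤ P.card ∧ A ⊆ S ∧ S.card ≤ 4 * A.card ∧
    ∑ i ∈ A, peelScore μ S W P i ≤ 0

/-- One factor `n ^ (-|P|)` is at most `1 / n`, and the other sums to `(1 + 1 / n) ^ n ≤ e`. This
pays for unions over all nonempty vertex sets. -/
lemma sum_inv_pow_card_le (hn : 1 ≤ n) :
    ∑ P : Finset (Fin n) with P.Nonempty, ((n : ℝ) ^ (2 * P.card))⁻¹ ≤ 3 / n := by
  have hn' : (0 : ℝ) < n := by exact_mod_cast hn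
  have hn1 : (1 : ℝ) ≤ n := by exact_mod_cast hn
  have h1 : ∑ P : Finset (Fin n), ((n : ℝ)⁻¹) ^ P.card = ((n : ℝ)⁻¹ + 1) ^ n := by
    simpa using Fintype.sum_pow_mul_eq_add_pow (Fin n) (n : ℝ)⁻¹ 1
  have h2 : ((n : ℝ)⁻¹ + 1) ^ n ≤ 3 := by
    calc ((n : ℝ)⁻¹ + 1) ^ n ≤ Real.exp (n : ℝ)⁻¹ ^ n := by
          gcongr; exact Real.add_one_le_exp _
      _ = Real.exp 1 := by rw [← Real.exp_nat_mul, mul_inv_cancel₀ hn'.ne']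
      _ ≤ 3 := by linarith [Real.exp_one_lt_d9]
  calc ∑ P : Finset (Fin n) with P.Nonempty, ((n : ℝ) ^ (2 * P.card))⁻¹
      ≤ ∑ P : Finset (Fin n) with P.Nonempty, (n : ℝ)⁻¹ * ((n : ℝ)⁻¹) ^ P.card := by
        refine Finset.sum_le_sum fun P hP => ?_
        have := (Finset.mem_filter.1 hP).2.card_pos
        rw [inv_pow, ← mul_inv, ← pow_succ']
        exact inv_anti₀ (by positivity) (pow_le_pow_right₀ hn1 (by omega))
    _ ≤ ∑ P : Finset (Fin n), (n : ℝ)⁻¹ * ((n : ℝ)⁻¹) ^ P.card :=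
        Finset.sum_le_sum_of_subset_of_nonneg (Finset.filter_subset _ _)
          fun P _ _ => by positivity
    _ = (n : ℝ)⁻¹ * ((n : ℝ)⁻¹ + 1) ^ n := by rw [← Finset.mul_sum, h1]
    _ ≤ (n : ℝ)⁻¹ * 3 := by gcongr
    _ = 3 / n := by ring

lemma measure_hasHighMean_le (hr : 0 < r) (hn : 1 ≤ n) (μ : ℝ) (S : Finset (Fin n)) {R : ℝ}
    (hR0 : 0 ≤ R) (hR : R ^ 2 = 64 * ((n : ℝ) ^ (r - 1) * Real.log n)) :
    (noise n r).real {W | HasHighMean μ S R W} ≤ 3 / n := by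
  have hn1 : (1 : ℝ) ≤ n := by exact_mod_cast hn
  have hsub : {W : Tensor n r | HasHighMean μ S R W} ⊆
      ⋃ P ∈ (Finset.univ.filter fun P : Finset (Fin n) => P.Nonempty),
        {W | P.card ≤ 3 * (P \ S).card ∧
          ((P \ S).card : ℝ) * ((P.card : ℝ) ^ (r - 1) * meanPosPart + R) ≤
            ∑ i ∈ P \ S, peelScore μ S W P i} := by
    rintro W ⟨P, hP, h⟩
    simp only [Set.mem_iUnion]
    exact ⟨P, by simpa using hP, h⟩
  refine (measureReal_mono hsub (measure_ne_top _ _)).trans ((measureReal_biUnion_finset_le _ _).trans ?_)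
  refine le_trans (Finset.sum_le_sum fun P hP => ?_) (sum_inv_pow_card_le hn)
  by_cases hPS : P.card ≤ 3 * (P \ S).card
  · simp only [hPS, true_and]
    refine (measure_sum_sdiff_ge_le hr hn μ S P hR0 hR (Finset.mem_filter.1 hP).2 hPS).trans ?_
    exact inv_anti₀ (by positivity) (pow_le_pow_right₀ hn1 (by omega))
  · simp only [hPS, false_and, Set.ofPred_false, measureReal_empty]
    positivity

lemma measure_hasManyZeros_le (hr : 2 ≤ r) (hn : 2 ≤ n) {μ : ℝ} (hμ : 0 ≤ μ) (S : Finset (Fin n))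
    (hS : 1 ≤ S.card) (hlog : 80 * Real.log n ≤ S.card * meanPosPart ^ 2) :
    (noise n r).real {W | HasManyZeros μ S W} ≤ 3 / n := by
  have hn1 : (1 : ℝ) ≤ n := by exact_mod_cast (by omega : 1 ≤ n)
  let F : Finset (Finset (Fin n)) := S.powerset.filter fun A => S.card ≤ 4 * A.card
  have hsub : {W : Tensor n r | HasManyZeros μ S W} ⊆
      ⋃ P ∈ (Finset.univ.filter fun P : Finset (Fin n) => P.Nonempty),
        ⋃ A ∈ F, {W | S.card ≤ P.card ∧ ∑ i ∈ A, peelScore μ S W P i ≤ 0} := by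
    rintro W ⟨P, A, hP, hSP, hA, hcard, h⟩
    simp only [Set.mem_iUnion]
    exact ⟨P, by simpa using hP, A, Finset.mem_filter.2 ⟨Finset.mem_powerset.2 hA, hcard⟩, hSP, h⟩
  refine (measureReal_mono hsub (measure_ne_top _ _)).trans ((measureReal_biUnion_finset_le _ _).trans ?_)
  refine le_trans (Finset.sum_le_sum fun P hP => ?_) (sum_inv_pow_card_le (by omega : 1 ≤ n))
  by_cases hSP : S.card ≤ P.card
  · simp only [hSP, true_and]
    refine (measureReal_biUnion_finset_le _ _).trans ?_
    calc _ ≤ ∑ A ∈ F, ((n : ℝ) ^ (5 * P.card))⁻¹ := Finset.sum_le_sum fun A hA =>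
          measure_sum_nonpos_le hr (by omega) hμ S P A (Finset.mem_filter.1 hP).2 hS
            (Finset.mem_filter.1 hA).2 hlog
      _ = F.card * ((n : ℝ) ^ (5 * P.card))⁻¹ := by simp
      -- The number of sets `A` is at most `2 ^ |S| ≤ n ^ |P|`; this is why `HasManyZeros` requires
      -- `|S| ≤ |P|`.
      _ ≤ (n : ℝ) ^ P.card * ((n : ℝ) ^ (5 * P.card))⁻¹ := by
          gcongr
          have h1 := Finset.card_filter_le S.powerset fun A => S.card ≤ 4 * A.card
          rw [Finset.card_powerset] at h1
          have h2 : 2 ^ S.card ≤ n ^ P.card :=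
            (Nat.pow_le_pow_right (by omega) hSP).trans (Nat.pow_le_pow_left hn _)
          exact_mod_cast h1.trans h2
      _ = ((n : ℝ) ^ (4 * P.card))⁻¹ := by
          have : (n : ℝ) ^ (5 * P.card) = (n : ℝ) ^ P.card * (n : ℝ) ^ (4 * P.card) := by ring
          rw [this, mul_inv, mul_inv_cancel_left₀ (by positivity)]
      _ ≤ ((n : ℝ) ^ (2 * P.card))⁻¹ := by
          exact inv_anti₀ (by positivity) (pow_le_pow_right₀ hn1 (by omega))
  · simp only [hSP, false_and, Set.ofPred_false, Set.iUnion_empty, measureReal_empty]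
    positivity

/-- Outside the exceptional events, every run of greedy peeling retains an eighth of the support. -/
lemma overlap_of_not_events {μ : ℝ} {S : Finset (Fin n)} {R : ℝ} {W : Tensor n r} {k : ℕ}
    (hk : 1 ≤ k) (hS : S.card = k) (hkn : 3 * k ≤ 2 * n)
    (htie : ¬ HasTie μ S W) (hlow : ¬ HasLowRun μ S k R W) (hmean : ¬ HasHighMean μ S R W)
    (hzero : ¬ HasManyZeros μ S W) {p : ℕ → Finset (Fin n)}
    (hp : IsPath (peelScore μ S W) p (n - 3 * k / 2)) :
    k ≤ 8 * (p (n - 3 * k / 2) ∩ S).card := by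
  classical
  by_contra hfail
  -- `L` is the first time at which less than an eighth of the support is left, so every earlier set
  -- still has enough signal.
  have hex : ∃ t, 8 * (p t ∩ S).card < k := ⟨_, not_le.1 hfail⟩
  set L := Nat.find hex with hLdef
  have hL : 8 * (p L ∩ S).card < k := Nat.find_spec hex
  have hLle : L ≤ n - 3 * k / 2 := Nat.find_min' hex (not_le.1 hfail)
  have hbefore : ∀ t < L, k ≤ 8 * (p t ∩ S).card := fun t ht => not_lt.1 (Nat.find_min hex ht)
  have hp := hp.mono hLle
  have hcard : ∀ t ≤ L, (p t).card = n - t := fun t ht => by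
    rw [hp.card t ht, Fintype.card_fin]
  choose τ hτL hτ using fun i => hp.exists_removalTime i
  have hτlt : ∀ i, i ∉ p L → τ i < L := fun i hi =>
    lt_of_le_of_ne (hτL i) fun h => hi ((hτ i L le_rfl).2 h.ge)
  have hmem : ∀ i, i ∈ p (τ i) := fun i => (hτ i _ (hτL i)).2 le_rfl
  have hnot : ∀ i, i ∉ p L → i ∉ p (τ i + 1) := fun i hi h =>
    absurd ((hτ i _ (hτlt i hi)).1 h) (by omega)
  have hmin : ∀ i, i ∉ p L → ∀ l ∈ p (τ i),
      peelScore μ S W (p (τ i)) i ≤ peelScore μ S W (p (τ i)) l := by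
    intro i hi l hl
    obtain ⟨ℓ, hℓ, hℓmin, h⟩ := hp.2 (τ i) (hτlt i hi)
    have : i = ℓ := by
      by_contra hne
      exact hnot i hi (h ▸ Finset.mem_erase.2 ⟨hne, hmem i⟩)
    exact this ▸ hℓmin l hl
  -- More than `7k / 8` support vertices are gone by time `L`. Fewer than `k / 4` of them left with
  -- score zero, so `A` has at least `k / 2` elements.
  let A := (S \ p L).filter fun i => 0 < peelScore μ S W (p (τ i)) i
  let Z := (S \ p L).filter fun i => ¬ 0 < peelScore μ S W (p (τ i)) i
  have hAZ : A.card + Z.card = (S \ p L).card := Finset.card_filter_add_card_filter_not _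
  have hSL : (p L ∩ S).card + (S \ p L).card = k := by
    rw [Finset.inter_comm, Finset.card_inter_add_card_sdiff, hS]
  have hZ : 4 * Z.card < k := by
    by_contra hZ
    -- Scores only decrease along the run, so all vertices of `Z` have score zero at the single set
    -- `p L`.
    refine hzero ⟨p L, Z, Finset.card_pos.1 ?_, ?_, ?_, by omega, Finset.sum_nonpos fun i hi => ?_⟩
    · rw [hcard L le_rfl]; omega
    · rw [hcard L le_rfl]; omega
    · exact (Finset.filter_subset _ _).trans Finset.sdiff_subset
    · exact (peelScore_mono μ S W i (hp.subset (hτL i) le_rfl)).trans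
        (not_lt.1 (Finset.mem_filter.1 hi).2)
  have hLn : L < n + 1 := by omega
  refine hlow ⟨htie, fun s => p s, ⟨L, hLn⟩, A, ?_,
    (Finset.filter_subset _ _).trans Finset.sdiff_subset, by omega, fun i hi => ?_⟩
  · refine ⟨by rw [extend_of_le _ (Nat.zero_le n)]; exact hp.1, fun t ht => ?_⟩
    have ht : t < L := ht
    rw [extend_of_le _ (by omega : t ≤ n), extend_of_le _ (by omega : t + 1 ≤ n)]
    exact hp.2 t ht
  · obtain ⟨hiS, hpos⟩ := Finset.mem_filter.1 hi
    have hiL : i ∉ p L := (Finset.mem_sdiff.1 hiS).2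
    have hlt := hτlt i hiL
    refine ⟨τ i, hlt, ?_⟩
    rw [extend_of_le _ (by omega : τ i ≤ n), extend_of_le _ (by omega : τ i + 1 ≤ n)]
    refine ⟨hmem i, hnot i hiL, fun l hl => hpos.trans_le (hmin i hiL l (Finset.mem_sdiff.1 hl).1),
      hbefore _ hlt, ?_⟩
    have hc := hcard (τ i) hlt.le
    have hsd : (p (τ i)).card ≤ (p (τ i) \ S).card + k := by
      rw [← hS]; have := Finset.card_inter_add_card_sdiff (p (τ i)) S
      have h2 := Finset.card_le_card (Finset.inter_subset_right : p (τ i) ∩ S ⊆ S)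
      omega
    by_contra hgt
    -- More than `⌊3k / 2⌋` vertices remain and at most `k` lie in `S`, so at least a third are
    -- outside. Were the minimal score of `i` too large, every outside score would be, and so would
    -- their mean.
    refine hmean ⟨p (τ i), ⟨i, hmem i⟩, by omega, ?_⟩
    rw [← nsmul_eq_mul]
    exact Finset.card_nsmul_le_sum _ _ _ fun l hl =>
      (not_le.1 hgt).le.trans (hmin i hiL l (Finset.mem_sdiff.1 hl).1)

lemma measure_not_succeeds_le (hr : 2 ≤ r) (hn : 2 ≤ n) {k : ℕ} (hk : 1 ≤ k) (hkn : 3 * k ≤ 2 * n)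
    {lam : ℝ} (hlam : 0 ≤ lam) (S : Finset (Fin n)) (hS : S.card = k)
    {R : ℝ} (hR0 : 0 ≤ R) (hR : R ^ 2 = 64 * ((n : ℝ) ^ (r - 1) * Real.log n))
    (hsnr : 4 * R * 8 ^ (r - 1) ≤ lam / (k : ℝ) ^ ((r : ℝ) / 2) * (k : ℝ) ^ (r - 1))
    (hlog : 80 * Real.log n ≤ k * meanPosPart ^ 2) :
    noise n r {W | ¬ Succeeds k (indicatorVec S) (observation k lam (indicatorVec S) W)} ≤
      ENNReal.ofReal (7 / n) := by
  set μ := lam / (k : ℝ) ^ ((r : ℝ) / 2) with hμdef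
  have hμ : 0 ≤ μ := by positivity
  have hr0 : 0 < r := by omega
  have hsub : {W : Tensor n r |
      ¬ Succeeds k (indicatorVec S) (observation k lam (indicatorVec S) W)} ⊆
      (({W | HasTie μ S W} ∪ {W | HasLowRun μ S k R W}) ∪ {W | HasHighMean μ S R W}) ∪
        {W | HasManyZeros μ S W} := by
    intro W hW
    by_contra hcon
    simp only [Set.mem_union, Set.mem_ofPred_eq, not_or] at hcon
    obtain ⟨⟨⟨h1, h2⟩, h3⟩, h4⟩ := hcon
    exact hW (succeeds_of_paths (by omega) lam S W fun p hp =>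
      overlap_of_not_events hk hS hkn h1 h2 h3 h4 hp)
  have h2 := measure_hasLowRun_le hr0 hn hμ S hR0 hR hk hS hsnr
  have h3 := measure_hasHighMean_le hr0 (by omega : 1 ≤ n) μ S hR0 hR
  have h4 := measure_hasManyZeros_le hr hn hμ S (by omega) (by rw [hS]; exact hlog)
  have h3' : noise n r {W | HasHighMean μ S R W} ≤ ENNReal.ofReal (3 / n) := by
    rw [← ofReal_measureReal]; exact ENNReal.ofReal_le_ofReal h3
  have h4' : noise n r {W | HasManyZeros μ S W} ≤ ENNReal.ofReal (3 / n) := by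
    rw [← ofReal_measureReal]; exact ENNReal.ofReal_le_ofReal h4
  calc _ ≤ ((noise n r {W | HasTie μ S W} + noise n r {W | HasLowRun μ S k R W}) +
        noise n r {W | HasHighMean μ S R W}) + noise n r {W | HasManyZeros μ S W} := by
        refine (measure_mono hsub).trans ((measure_union_le _ _).trans ?_)
        gcongr
        refine (measure_union_le _ _).trans ?_
        gcongr
        exact measure_union_le _ _
    _ ≤ ((0 + ENNReal.ofReal (1 / n)) + ENNReal.ofReal (3 / n)) + ENNReal.ofReal (3 / n) := by
        rw [measure_hasTie hr0 μ S]
        gcongr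
    _ = ENNReal.ofReal (7 / n) := by
        rw [zero_add, ← ENNReal.ofReal_add (by positivity) (by positivity),
          ← ENNReal.ofReal_add (by positivity) (by positivity)]
        congr 1
        ring

end Events

/-! ### Averaging over the signal and asymptotics of the parameters -/

section Limit

/-- As `κ` is carried by a finite set, `B` is covered by finitely many rectangles and a null one. No
measurability of `B` is needed. -/
lemma prod_measure_le_of_sections {X Y : Type*} [MeasurableSpace X] [MeasurableSpace Y]
    [MeasurableSingletonClass X] (κ : Measure X) [IsProbabilityMeasure κ] (ν : Measure Y)
    [SFinite ν] {T : Set X} (hT : T.Finite) (hκ : κ Tᶜ = 0) {B : Set (X × Y)} {ε : ENNReal}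
    (h : ∀ x ∈ T, ν {y | (x, y) ∈ B} ≤ ε) : (κ.prod ν) B ≤ ε := by
  have hsub : B ⊆ (Tᶜ ×ˢ Set.univ) ∪ ⋃ x ∈ hT.toFinset, {x} ×ˢ {y | (x, y) ∈ B} := by
    rintro ⟨x, y⟩ hxy
    by_cases hx : x ∈ T
    · refine Or.inr ?_
      simp only [Set.mem_iUnion]
      exact ⟨x, by simpa using hx, rfl, hxy⟩
    · exact Or.inl ⟨hx, trivial⟩
  calc (κ.prod ν) B ≤ (κ.prod ν) (Tᶜ ×ˢ Set.univ) +
        (κ.prod ν) (⋃ x ∈ hT.toFinset, {x} ×ˢ {y | (x, y) ∈ B}) :=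
        (measure_mono hsub).trans (measure_union_le _ _)
    _ = (κ.prod ν) (⋃ x ∈ hT.toFinset, {x} ×ˢ {y | (x, y) ∈ B}) := by
        rw [Measure.prod_prod, hκ, zero_mul, zero_add]
    _ ≤ ∑ x ∈ hT.toFinset, κ {x} * ε := by
        refine (measure_biUnion_finset_le _ _).trans (Finset.sum_le_sum fun x hx => ?_)
        rw [Measure.prod_prod]
        gcongr
        exact h x (by simpa using hx)
    _ = κ hT.toFinset * ε := by
        rw [← Finset.sum_mul, sum_measure_singleton]
    _ ≤ 1 * ε := by
        gcongr
        exact prob_le_one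
    _ = ε := one_mul ε

lemma sparseBinary_eq_image (n k : ℕ) :
    sparseBinary n k = indicatorVec '' {S : Finset (Fin n) | S.card = k} := by
  ext v
  constructor
  · rintro ⟨h01, hk⟩
    have hv : v = indicatorVec (Finset.univ.filter fun i => v i ≠ 0) := by
      ext i
      rcases h01 i with h | h <;> simp [indicatorVec, h]
    exact ⟨_, by rw [← hk, hammingNorm]; rfl, hv.symm⟩
  · rintro ⟨S, hS, rfl⟩
    refine ⟨fun i => ?_, (hammingNorm_indicatorVec S).trans hS⟩
    by_cases hi : i ∈ S <;> simp [indicatorVec, hi]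

lemma finite_sparseBinary (n k : ℕ) : (sparseBinary n k).Finite := by
  rw [sparseBinary_eq_image]
  exact (Set.toFinite _).image _

lemma sparseBinary_nonempty {n k : ℕ} (h : k ≤ n) : (sparseBinary n k).Nonempty := by
  rw [sparseBinary_eq_image]
  obtain ⟨S, -, hS⟩ := Finset.exists_subset_card_eq (s := (Finset.univ : Finset (Fin n)))
    (n := k) (by simpa using h)
  exact ⟨_, S, hS, rfl⟩

lemma one_sub_le_jointLaw {n r : ℕ} (hr : 2 ≤ r) (hn : 2 ≤ n) {k : ℕ} (hk : 1 ≤ k)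
    (hkn : 3 * k ≤ 2 * n) {lam : ℝ} (hlam : 0 ≤ lam)
    {R : ℝ} (hR0 : 0 ≤ R) (hR : R ^ 2 = 64 * ((n : ℝ) ^ (r - 1) * Real.log n))
    (hsnr : 4 * R * 8 ^ (r - 1) ≤ lam / (k : ℝ) ^ ((r : ℝ) / 2) * (k : ℝ) ^ (r - 1))
    (hlog : 80 * Real.log n ≤ k * meanPosPart ^ 2) :
    1 - ENNReal.ofReal (7 / n) ≤
      jointLaw n k r {p | Succeeds k p.1 (observation k lam p.1 p.2)} ∧
    jointLaw n k r {p | Succeeds k p.1 (observation k lam p.1 p.2)} ≤ 1 := by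
  have hfin := finite_sparseBinary n k
  have hprob : IsProbabilityMeasure (uniformOn (sparseBinary n k)) :=
    isProbabilityMeasure_uniformOn hfin (sparseBinary_nonempty (by omega))
  have hprob' : IsProbabilityMeasure (jointLaw n k r) := by
    unfold jointLaw; infer_instance
  refine ⟨?_, prob_le_one⟩
  have hc : uniformOn (sparseBinary n k) (sparseBinary n k)ᶜ = 0 :=
    (prob_compl_eq_zero_iff hfin.measurableSet).2
      (uniformOn_self hfin (sparseBinary_nonempty (by omega)))
  have hbad : jointLaw n k r {p | Succeeds k p.1 (observation k lam p.1 p.2)}ᶜ ≤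
      ENNReal.ofReal (7 / n) := by
    refine prod_measure_le_of_sections _ _ hfin hc fun θ hθ => ?_
    rw [sparseBinary_eq_image] at hθ
    obtain ⟨S, hS, rfl⟩ := hθ
    exact measure_not_succeeds_le hr hn hk hkn hlam S hS hR0 hR hsnr hlog
  rw [tsub_le_iff_right]
  calc (1 : ENNReal) = jointLaw n k r Set.univ := measure_univ.symm
    _ ≤ _ := by
      rw [← Set.union_compl_self {p | Succeeds k p.1 (observation k lam p.1 p.2)}]
      exact (measure_union_le _ _).trans (by gcongr)

/-- Since `μ k ^ (r-1) = lam k ^ (r/2 - 1)`, the assumed lower bound on `lam` is exactly the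
required signal strength. The constant is `32 = 4 * 8`, the `8` coming from `R`. -/
lemma snr_le {n k r : ℕ} (hr : 2 ≤ r) (hk : 1 ≤ k) {lam : ℝ}
    (h : 32 * 8 ^ (r - 1) * ((n : ℝ) ^ (((r : ℝ) - 1) / 2) / (k : ℝ) ^ ((r : ℝ) / 2 - 1))
      * Real.sqrt (Real.log n) ≤ lam) :
    4 * (8 * (Real.sqrt ((n : ℝ) ^ (r - 1)) * Real.sqrt (Real.log n))) * 8 ^ (r - 1) ≤
      lam / (k : ℝ) ^ ((r : ℝ) / 2) * (k : ℝ) ^ (r - 1) := by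
  have hk0 : (0 : ℝ) < k := by exact_mod_cast hk
  have hcast : ((r - 1 : ℕ) : ℝ) = (r : ℝ) - 1 := by
    rw [Nat.cast_sub (by omega)]; simp
  have hsqrt : Real.sqrt ((n : ℝ) ^ (r - 1)) = (n : ℝ) ^ (((r : ℝ) - 1) / 2) := by
    rw [Real.sqrt_eq_rpow, ← Real.rpow_natCast, ← Real.rpow_mul (Nat.cast_nonneg n), hcast]
    congr 1; ring
  have hkpow : (k : ℝ) ^ (r - 1) = (k : ℝ) ^ ((r : ℝ) / 2 - 1) * (k : ℝ) ^ ((r : ℝ) / 2) := by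
    rw [← Real.rpow_natCast, ← Real.rpow_add hk0, hcast]
    congr 1; ring
  have hp1 : 0 < (k : ℝ) ^ ((r : ℝ) / 2) := Real.rpow_pos_of_pos hk0 _
  have hp2 : 0 < (k : ℝ) ^ ((r : ℝ) / 2 - 1) := Real.rpow_pos_of_pos hk0 _
  have e : lam / (k : ℝ) ^ ((r : ℝ) / 2) * (k : ℝ) ^ (r - 1) =
      lam * (k : ℝ) ^ ((r : ℝ) / 2 - 1) := by
    rw [hkpow]; field_simp
  rw [hsqrt, e]
  calc _ = 32 * 8 ^ (r - 1) * ((n : ℝ) ^ (((r : ℝ) - 1) / 2) / (k : ℝ) ^ ((r : ℝ) / 2 - 1))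
      * Real.sqrt (Real.log n) * (k : ℝ) ^ ((r : ℝ) / 2 - 1) := by field_simp; ring
    _ ≤ _ := by gcongr

/-- As `log n = o(√n)`, the growth of `k` makes `log n` smaller than any fixed multiple of `k`, as
the bound on vanishing scores requires. -/
lemma eventually_log_le {k : ℕ → ℕ} {c : ℝ} (hc : 0 < c)
    (hk : ∀ᶠ n : ℕ in atTop, c * Real.sqrt (n : ℝ) ≤ (k n : ℝ)) :
    ∀ᶠ n : ℕ in atTop, 80 * Real.log n ≤ k n * meanPosPart ^ 2 := by
  have he := meanPosPart_pos
  have h := ((isLittleO_log_rpow_atTop (r := 1 / 2) (by norm_num)).bound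
    (c := c * meanPosPart ^ 2 / 80) (by positivity))
  filter_upwards [hk, tendsto_natCast_atTop_atTop.eventually h] with n h1 h2
  rw [Real.norm_eq_abs, Real.norm_eq_abs, ← Real.sqrt_eq_rpow, abs_of_nonneg (Real.sqrt_nonneg _),
    abs_of_nonneg (Real.log_natCast_nonneg n)] at h2
  have h3 : c * Real.sqrt n * meanPosPart ^ 2 ≤ k n * meanPosPart ^ 2 := by gcongr
  linarith

end Limit

end GreedyPeeling

theorem theorem2p2 (r : ℕ) (hr : 2 ≤ r) :
    ∃ C : ℝ, 0 < C ∧ ∀ (k : ℕ → ℕ) (lam : ℕ → ℝ),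
      (∃ c : ℝ, 0 < c ∧ ∀ᶠ n : ℕ in atTop, c * Real.sqrt (n : ℝ) ≤ (k n : ℝ)) →
      (∀ᶠ n : ℕ in atTop, (k n : ℝ) ≤ 2 / 3 * (n : ℝ)) →
      (∀ᶠ n : ℕ in atTop,
        C * ((n : ℝ) ^ (((r : ℝ) - 1) / 2) / (k n : ℝ) ^ ((r : ℝ) / 2 - 1))
          * Real.sqrt (Real.log (n : ℝ)) ≤ lam n) →
      Tendsto
        (fun n : ℕ => SparseTensorPCA.jointLaw n (k n) r
          {p | SparseTensorPCA.Succeeds (k n) p.1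
            (SparseTensorPCA.observation (k n) (lam n) p.1 p.2)})
        atTop (𝓝 1) := by
  refine ⟨32 * 8 ^ (r - 1), by positivity, ?_⟩
  rintro k lam ⟨c, hc, hck⟩ hkn hlam
  have hbounds : ∀ᶠ n : ℕ in atTop, 1 - ENNReal.ofReal (7 / n) ≤
      SparseTensorPCA.jointLaw n (k n) r {p | SparseTensorPCA.Succeeds (k n) p.1
        (SparseTensorPCA.observation (k n) (lam n) p.1 p.2)} ∧
      SparseTensorPCA.jointLaw n (k n) r {p | SparseTensorPCA.Succeeds (k n) p.1
        (SparseTensorPCA.observation (k n) (lam n) p.1 p.2)} ≤ 1 := by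
    filter_upwards [hck, hkn, hlam, GreedyPeeling.eventually_log_le hc hck,
      eventually_ge_atTop 2] with n h1 h2 h3 h4 hn
    have hn0 : (0 : ℝ) < n := by positivity
    have hk : 1 ≤ k n := by
      have : (0 : ℝ) < k n := lt_of_lt_of_le (by positivity) h1
      exact_mod_cast this
    have hkn' : 3 * k n ≤ 2 * n := by
      have : (3 : ℝ) * k n ≤ 2 * n := by linarith
      exact_mod_cast this
    refine GreedyPeeling.one_sub_le_jointLaw hr hn hk hkn' (le_trans (by positivity) h3)
      (R := 8 * (Real.sqrt ((n : ℝ) ^ (r - 1)) * Real.sqrt (Real.log n)))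
      (by positivity) ?_ (GreedyPeeling.snr_le hr hk h3) h4
    rw [mul_pow, mul_pow, Real.sq_sqrt (by positivity), Real.sq_sqrt (Real.log_natCast_nonneg n)]
    norm_num
  have hlim : Tendsto (fun n : ℕ => 1 - ENNReal.ofReal (7 / n)) atTop (𝓝 1) := by
    have h0 : Tendsto (fun n : ℕ => ENNReal.ofReal (7 / n)) atTop (𝓝 0) := by
      have := ENNReal.tendsto_ofReal (tendsto_const_div_atTop_nhds_zero_nat (7 : ℝ))
      rwa [ENNReal.ofReal_zero] at this
    have := ENNReal.Tendsto.sub (tendsto_const_nhds (x := (1 : ENNReal))) h0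
      (Or.inl ENNReal.one_ne_top)
    rwa [tsub_zero] at this
  exact tendsto_of_tendsto_of_tendsto_of_le_of_le' hlim tendsto_const_nhds
    (hbounds.mono fun _ h => h.1) (hbounds.mono fun _ h => h.2)
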